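/- Let $G$ be a finite connected simple graph with vertex set $V$. Suppose that $l$ is a leaf (a vertex of degree $1$) of $G$, that $c$ is the nearest vertex to $l$ of degree greater than $2$, and that $c,c_1,\dots,c_k,l$ ($k\ge 0$) are the vertices of the path from $c$ to $l$. Let $F\subseteq V\setminus\{c,c_1,\dots,c_k,l\}$ be such that the subgraph induced on $F\cup\{c\}$ is a tree, no vertex outside $F\cup\{c\}$ is adjacent to a vertex of $F$, and $V\setminus(F\cup\{c,c_1,\dots,c_k,l\})\neq\emptyset$. The corresponding tree shift $G'$ of $G$ is the graph on $V$ obtained from $G$ by replacing every edge $(v,c)$ with $v\in F$ by the edge $(v,l)$. For a graph $H$ on $V$, let $\mathcal B(H)$ be the set of nonempty subsets $I\subseteq V$ whose induced subgraph in $H$ is connected, and let $P_{\mathcal B(H)}=\sum_{I\in\mathcal B(H)}\mathrm{ConvexHull}(e_i\mid i\in I)\subseteq\mathbb R^V$ (Minkowski sum) be the graph-associahedron of $H$. For a $d$-dimensional simple polytope $P$ with $f_i$ faces of dimension $i$, put $f(P)(t)=\sum_{i=0}^d f_it^i$ and define $h(P)$ by $h(P)(t+1)=f(P)(t)$; the $\gamma$-polynomial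 $\gamma(P)(t)=\sum_{i=0}^{\lfloor d/2\rfloor}\gamma_it^i\in\mathbb Z[t]$ is the unique polynomial with $h(P)(t)=\sum_{i=0}^{\lfloor d/2\rfloor}\gamma_it^i(1+t)^{d-2i}$. Write $\gamma(\mathcal B(H))=\gamma(P_{\mathcal B(H)})$. Then $\gamma(\mathcal B(G))$ and $\gamma(\mathcal B(G'))$ exist, and $\gamma(\mathcal B(G'))\le\gamma(\mathcal B(G))$ coefficientwise: for every $i$, the coefficient of $t^i$ in $\gamma(\mathcal B(G'))$ is at most the coefficient of $t^i$ in $\gamma(\mathcal B(G))$. -/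

import Mathlib

open Polynomial
open scoped Pointwise

/-! Faces, and the `f`-, `h`- and `γ`-polynomials of a polytope in `ℝ^V`. -/

section Polytope

variable {V : Type*}

/-- The dimension of a set `P ⊆ ℝ^V`: the dimension of its affine span. -/
noncomputable def polytopeDim (P : Set (V → ℝ)) : ℕ :=
  Module.finrank ℝ (vectorSpan ℝ P)

/-- `faceCount P i` is the number of `i`-dimensional faces of the polytope `P`. The nonempty faces
of a polytope are its nonempty exposed subsets, that is, the sets of maximizers on `P` of linear
functionals; `P` itself is a face (the zero functional). -/
noncomputable def faceCount (P : Set (V → ℝ)) (i : ℕ) : ℕ :=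
  {F : Set (V → ℝ) | IsExposed ℝ P F ∧ F.Nonempty ∧ polytopeDim F = i}.ncard

/-- `f(P)(t) = f_0 + f_1 t + ⋯ + f_d t^d`. -/
noncomputable def fPolynomial (P : Set (V → ℝ)) : ℤ[X] :=
  ∑ i ∈ Finset.range (polytopeDim P + 1), C (faceCount P i : ℤ) * X ^ i

/-- The `h`-polynomial, determined by `h(P)(t + 1) = f(P)(t)`. -/
noncomputable def hPolynomial (P : Set (V → ℝ)) : ℤ[X] :=
  (fPolynomial P).comp (X - 1)

theorem hPolynomial_comp (P : Set (V → ℝ)) : (hPolynomial P).comp (X + 1) = fPolynomial P := by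
  simp [hPolynomial, comp_assoc]

/-- `g = γ_0 + γ_1 t + ⋯ + γ_{⌊d/2⌋} t^{⌊d/2⌋}` is a `γ`-polynomial of the `d`-dimensional
polytope `P`: `h(P)(t) = ∑_{i ≤ d/2} γ_i t^i (1 + t)^{d - 2 i}`. -/
def IsGammaPolynomial (P : Set (V → ℝ)) (g : ℤ[X]) : Prop :=
  g.natDegree ≤ polytopeDim P / 2 ∧
    hPolynomial P = ∑ i ∈ Finset.range (polytopeDim P / 2 + 1),
      C (g.coeff i) * X ^ i * (1 + X) ^ (polytopeDim P - 2 * i)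

theorem IsGammaPolynomial.unique {P : Set (V → ℝ)} {g g' : ℤ[X]}
    (hg : IsGammaPolynomial P g) (hg' : IsGammaPolynomial P g') : g = g' := by
  have key : ∀ (a : ℤ[X]) (m d i : ℕ), i ≤ m →
      (∑ j ∈ Finset.range (m + 1), C (a.coeff j) * X ^ j * (1 + X) ^ (d - 2 * j) : ℤ[X]).coeff i =
        a.coeff i + ∑ j ∈ Finset.range i,
          a.coeff j * ((1 + X : ℤ[X]) ^ (d - 2 * j)).coeff (i - j) := by
    intro a m d i hi
    have hterm : ∀ j, (C (a.coeff j) * X ^ j * (1 + X) ^ (d - 2 * j) : ℤ[X]).coeff i =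
        if j ≤ i then a.coeff j * ((1 + X : ℤ[X]) ^ (d - 2 * j)).coeff (i - j) else 0 := by
      intro j
      rw [mul_assoc, coeff_C_mul, coeff_X_pow_mul']
      split_ifs <;> simp
    rw [finsetSum_coeff, Finset.sum_congr rfl (fun j _ => hterm j), ← Finset.sum_filter]
    have hset : (Finset.range (m + 1)).filter (fun j => j ≤ i) = Finset.range (i + 1) := by
      ext j
      simp only [Finset.mem_filter, Finset.mem_range]
      omega
    rw [hset, Finset.sum_range_succ, add_comm]
    congr 1
    simp [coeff_zero_eq_eval_zero]
  ext i
  induction i using Nat.strong_induction_on with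
  | _ i ih =>
    rcases le_or_gt i (polytopeDim P / 2) with hi | hi
    · have h := congrArg (fun q : ℤ[X] => q.coeff i) (hg.2.symm.trans hg'.2)
      simp only [key _ _ _ _ hi] at h
      rw [Finset.sum_congr rfl (fun j hj => by rw [ih j (Finset.mem_range.1 hj)])] at h
      exact add_right_cancel h
    · rw [coeff_eq_zero_of_natDegree_lt (hg.1.trans_lt hi),
        coeff_eq_zero_of_natDegree_lt (hg'.1.trans_lt hi)]

open Classical in
/-- The `γ`-polynomial of `P` (which is unique if it exists; the value is `0` if it does not). -/
noncomputable def gammaPolynomial (P : Set (V → ℝ)) : ℤ[X] :=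
  if h : ∃ g, IsGammaPolynomial P g then h.choose else 0

end Polytope

/-- A building set on the finite set `V`. -/
structure BuildingSet (V : Type*) [DecidableEq V] where
  sets : Finset (Finset V)
  nonempty_of_mem : ∀ I ∈ sets, I.Nonempty
  union_mem : ∀ I ∈ sets, ∀ J ∈ sets, (I ∩ J).Nonempty → I ∪ J ∈ sets
  singleton_mem : ∀ v : V, {v} ∈ sets

/-- The simplex `Δ_I = ConvexHull (e_i | i ∈ I)` in `ℝ^V`. -/
def coordSimplex {V : Type*} [DecidableEq V] (I : Finset V) : Set (V → ℝ) :=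
  convexHull ℝ ((fun i : V => (Pi.single i 1 : V → ℝ)) '' (I : Set V))

/-- The nestohedron of a building set: the Minkowski sum of the simplices `Δ_I`, `I ∈ B`. -/
noncomputable def BuildingSet.nestohedron {V : Type*} [DecidableEq V] (B : BuildingSet V) :
    Set (V → ℝ) :=
  ∑ I ∈ B.sets, coordSimplex I

namespace SimpleGraph

variable {V : Type*}

open Classical in
/-- The graphical building set `B(G)`: the (nonempty) sets of vertices that induce a connected
subgraph. -/
noncomputable def buildingSet [Fintype V] [DecidableEq V] (G : SimpleGraph V) :
    BuildingSet V where
  sets := Finset.univ.filter fun I => (G.induce (I : Set V)).Connected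
  nonempty_of_mem I hI := by
    obtain ⟨⟨v, hv⟩⟩ := (Finset.mem_filter.1 hI).2.nonempty
    exact ⟨v, hv⟩
  union_mem I hI J hJ hIJ := by
    refine Finset.mem_filter.2 ⟨Finset.mem_univ _, ?_⟩
    rw [Finset.coe_union]
    exact induce_union_connected (Finset.mem_filter.1 hI).2.preconnected
      (Finset.mem_filter.1 hJ).2.preconnected (by exact_mod_cast hIJ)
  singleton_mem v := by
    refine Finset.mem_filter.2 ⟨Finset.mem_univ _, ?_⟩
    rw [Finset.coe_singleton]
    exact
      { preconnected := Preconnected.of_subsingleton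
        nonempty := ⟨⟨v, rfl⟩⟩ }

/-- The graph-associahedron of `G`. -/
noncomputable def graphAssociahedron [Fintype V] [DecidableEq V] (G : SimpleGraph V) :
    Set (V → ℝ) :=
  G.buildingSet.nestohedron

/-- Replace every edge `(v, c)` with `v ∈ F` by the edge `(v, l)`. -/
def reattach (G : SimpleGraph V) (F : Set V) (c l : V) : SimpleGraph V :=
  G.deleteEdges {e | ∃ v ∈ F, e = s(v, c)} ⊔ fromEdgeSet {e | ∃ v ∈ F, G.Adj v c ∧ e = s(v, l)}

/-- The properties and the extra data needed for a tree shift of `G`: the leaf `l`, the branch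
vertex `c`, the path `c, c_1, …, c_k, l` and the set of vertices `F`. -/
structure IsTreeShiftData [Fintype V] (G : SimpleGraph V) [DecidableRel G.Adj]
    (l c : V) (p : G.Walk c l) (F : Set V) : Prop where
  /-- `l` is a leaf. -/
  leaf : G.degree l = 1
  /-- `c` has degree greater than two. -/
  branch : 2 < G.degree c
  /-- No vertex of degree greater than two is nearer to `l` than `c`. -/
  nearest : ∀ w, 2 < G.degree w → G.dist l c ≤ G.dist l w
  isPath : p.IsPath
  /-- `F` contains no vertex of the path from `c` to `l`. -/
  disjoint : ∀ v ∈ F, v ∉ p.support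
  /-- `F ∪ c` induces a tree. -/
  isTree : (G.induce (insert c F)).IsTree
  /-- No vertex outside `F ∪ c` is joined to a vertex of `F`. -/
  closed : ∀ v ∈ F, ∀ w, G.Adj v w → w ∈ insert c F
  /-- The set `E` of the remaining vertices is nonempty. -/
  rest_nonempty : ∃ e, e ∉ F ∧ e ∉ p.support

/-- `G'` results from `G` by a tree shift. -/
def IsTreeShift [Fintype V] (G : SimpleGraph V) [DecidableRel G.Adj] (G' : SimpleGraph V) : Prop :=
  ∃ (l c : V) (p : G.Walk c l) (F : Set V),
    G.IsTreeShiftData l c p F ∧ G' = G.reattach F c l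

end SimpleGraph

set_option linter.unusedSectionVars false

/-! A linear functional `w` is maximized on a Minkowski sum summand by summand. Hence a face of the
graph-associahedron is recorded by the system `I ↦ argmaxOn w I` over connected `I`, and its
dimension is the rank of the differences `e_i - e_j` with `i, j` in a common member of the system.
The `h`-polynomial thus becomes a sum over such systems (`hVal`). It makes sense for every induced
subgraph and obeys two rules: it is multiplicative over separated unions (`hVal_union`), and on a
connected `U` one sums over the set `S` where `w` is maximal on `U` (`hVal_of_connOn`).

These rules give a deletion formula (`hVal_deleteEdge`): for an edge `e`, `h(G) = h(G - e) + x ∑_I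
h((G - e)|I) h(G/I)`, where `I` runs over the sets that are connected only thanks to `e`, and `G/I`
is the reconnected complement. Counting dimensions turns it into a formula for `γ` with the variable
`t` in place of `x` and whole components omitted from the sum (`graphGamma_deleteEdge`). By
induction every `γ` has natural coefficients, so `γ` grows with the edge set (`graphGamma_mono`).

The shift itself is treated in a more flexible setting (`ShiftConfig`): a graph `A`, a pendant path
`p 0, …, p m` with root `p 0` in `A`, and a separate graph `F` whose vertices `N` are joined either
to `p 0` (original) or to `p m` (shifted). If `A` has no edges, reversing the path is an
isomorphism. Otherwise delete the same edge of `A` in both graphs. Each `I` in the shifted formula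
also occurs in the original one, and both factors compare by induction or coincide, with one
exception: `I` may swallow `p 0, …, p (s - 1)` but not `p m`. In that case contracting `I` in the
original graph joins `p s` to all of `N`, so the contracted graph contains the one with `N` attached
at the new root `p s`, and monotonicity completes the comparison (`ShiftConfig.graphGamma_le`). -/

namespace SimpleGraph

/-! ### Maximizer systems and the `h`-polynomial as a sum over them -/

section FaceSystems

variable {V : Type*} [Fintype V] [DecidableEq V]

/-- `I` is nonempty and induces a connected subgraph of `G`, expressed by cuts. -/
def ConnOn (G : SimpleGraph V) (I : Finset V) : Prop :=
  I.Nonempty ∧ ∀ A ⊆ I, A.Nonempty → A ≠ I → ∃ a ∈ A, ∃ b ∈ I, b ∉ A ∧ G.Adj a b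

theorem ConnOn.subset_or {G : SimpleGraph V} {I U₁ U₂ : Finset V} (hI : G.ConnOn I)
    (hU : I ⊆ U₁ ∪ U₂) (h : ∀ a ∈ U₁, ∀ b ∈ U₂, ¬ G.Adj a b) : I ⊆ U₁ ∨ I ⊆ U₂ := by
  by_contra! hc
  obtain ⟨h1, h2⟩ := hc
  obtain ⟨x, hx, hx2⟩ := Finset.not_subset.1 h2
  have hx1 : x ∈ U₁ := (Finset.mem_union.1 (hU hx)).resolve_right hx2
  obtain ⟨a, ha, b, hb, hba, hab⟩ := hI.2 (I ∩ U₁) Finset.inter_subset_left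
    ⟨x, Finset.mem_inter.2 ⟨hx, hx1⟩⟩ (fun h => h1 (Finset.inter_eq_left.1 h))
  have hb1 : b ∉ U₁ := fun h => hba (Finset.mem_inter.2 ⟨hb, h⟩)
  exact h a (Finset.mem_inter.1 ha).2 b ((Finset.mem_union.1 (hU hb)).resolve_left hb1) hab

/-- The elements of `I` at which `w` is maximal. -/
noncomputable def argmaxOn (w : V → ℝ) (I : Finset V) : Finset V :=
  I.filter fun i => ∀ j ∈ I, w j ≤ w i

theorem mem_argmaxOn {w : V → ℝ} {I : Finset V} {i : V} :
    i ∈ argmaxOn w I ↔ i ∈ I ∧ ∀ j ∈ I, w j ≤ w i := by simp [argmaxOn]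

theorem argmaxOn_subset (w : V → ℝ) (I : Finset V) : argmaxOn w I ⊆ I := Finset.filter_subset _ _

theorem argmaxOn_nonempty (w : V → ℝ) {I : Finset V} (h : I.Nonempty) :
    (argmaxOn w I).Nonempty := by
  obtain ⟨i, hi, h⟩ := I.exists_max_image w h
  exact ⟨i, mem_argmaxOn.2 ⟨hi, h⟩⟩

theorem argmaxOn_congr {w w' : V → ℝ} {I : Finset V} (h : ∀ i ∈ I, w i = w' i) :
    argmaxOn w I = argmaxOn w' I := by
  ext i
  simp only [mem_argmaxOn]
  refine and_congr_right fun hi => forall₂_congr fun j hj => ?_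
  rw [h i hi, h j hj]

theorem argmaxOn_inter {w : V → ℝ} {I U : Finset V} (hI : I ⊆ U)
    (h : (I ∩ argmaxOn w U).Nonempty) : argmaxOn w I = I ∩ argmaxOn w U := by
  obtain ⟨x, hx⟩ := h
  obtain ⟨hxI, hxU⟩ := Finset.mem_inter.1 hx
  ext i
  simp only [Finset.mem_inter, mem_argmaxOn] at *
  refine and_congr_right fun hi => ⟨fun h => ⟨hI hi, fun j hj => ?_⟩, fun h j hj => h.2 j (hI hj)⟩
  exact (hxU.2 j hj).trans (h x hxI)

open scoped Classical in
/-- The system of all maximizers of `w` on the connected sets inside `U`. The faces of the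
graph-associahedron correspond to these systems. -/
noncomputable def faceSystem (G : SimpleGraph V) (U : Finset V) (w : V → ℝ) :
    Finset V → Finset V :=
  fun I => if I ⊆ U ∧ G.ConnOn I then argmaxOn w I else ∅

theorem faceSystem_subset (G : SimpleGraph V) (U : Finset V) (w : V → ℝ) (I : Finset V) :
    faceSystem G U w I ⊆ U := by
  unfold faceSystem
  split_ifs with h
  · exact (argmaxOn_subset w I).trans h.1
  · simp

theorem faceSystem_congr {G : SimpleGraph V} {U : Finset V} {w w' : V → ℝ}
    (h : ∀ i ∈ U, w i = w' i) : faceSystem G U w = faceSystem G U w' := by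
  funext I
  unfold faceSystem
  split_ifs with hI
  · exact argmaxOn_congr fun i hi => h i (hI.1 hi)
  · rfl

/-- The finite set of all maximizer systems. -/
noncomputable def faceSystems (G : SimpleGraph V) (U : Finset V) :
    Finset (Finset V → Finset V) :=
  (Set.toFinite (Set.range (faceSystem G U))).toFinset

theorem mem_faceSystems {G : SimpleGraph V} {U : Finset V} {σ : Finset V → Finset V} :
    σ ∈ faceSystems G U ↔ ∃ w, faceSystem G U w = σ := by simp [faceSystems]

/-- The direction of the face that corresponds to a system. -/
def dirSpan (σ : Finset V → Finset V) : Submodule ℝ (V → ℝ) :=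
  Submodule.span ℝ {x | ∃ I, ∃ i ∈ σ I, ∃ j ∈ σ I, x = Pi.single i 1 - Pi.single j 1}

noncomputable def sysDim (σ : Finset V → Finset V) : ℕ := Module.finrank ℝ (dirSpan σ)

theorem sub_mem_dirSpan {σ : Finset V → Finset V} {I : Finset V} {i j : V} (hi : i ∈ σ I)
    (hj : j ∈ σ I) : (Pi.single i 1 - Pi.single j 1 : V → ℝ) ∈ dirSpan σ :=
  Submodule.subset_span ⟨I, i, hi, j, hj, rfl⟩

theorem dirSpan_le {σ : Finset V → Finset V} {W : Submodule ℝ (V → ℝ)}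
    (h : ∀ I, ∀ i ∈ σ I, ∀ j ∈ σ I, (Pi.single i 1 - Pi.single j 1 : V → ℝ) ∈ W) :
    dirSpan σ ≤ W := by
  refine Submodule.span_le.2 ?_
  rintro x ⟨I, i, hi, j, hj, rfl⟩
  exact h I i hi j hj

theorem dirSpan_apply_eq_zero {σ : Finset V → Finset V} {A : Finset V} (h : ∀ I, σ I ⊆ A)
    {x : V → ℝ} (hx : x ∈ dirSpan σ) {v : V} (hv : v ∉ A) : x v = 0 := by
  have : dirSpan σ ≤ LinearMap.ker (LinearMap.proj v : (V → ℝ) →ₗ[ℝ] ℝ) := by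
    refine dirSpan_le fun I i hi j hj => ?_
    have h1 : v ≠ i := fun e => hv (e ▸ h I hi)
    have h2 : v ≠ j := fun e => hv (e ▸ h I hj)
    simp [h1, h2]
  exact this hx

/-- Directions supported on disjoint sets of coordinates intersect trivially, so their dimensions
add. -/
theorem sysDim_eq_add {σ σ₁ σ₂ : Finset V → Finset V} {A B : Finset V} (hA : ∀ I, σ₁ I ⊆ A)
    (hB : ∀ I, σ₂ I ⊆ B) (hAB : Disjoint A B) (h : dirSpan σ = dirSpan σ₁ ⊔ dirSpan σ₂) :
    sysDim σ = sysDim σ₁ + sysDim σ₂ := by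
  have hinf : dirSpan σ₁ ⊓ dirSpan σ₂ = ⊥ := by
    rw [eq_bot_iff]
    rintro x ⟨h1, h2⟩
    refine (Submodule.mem_bot ℝ).2 (funext fun v => ?_)
    by_cases hv : v ∈ A
    · exact dirSpan_apply_eq_zero hB h2 (Finset.disjoint_left.1 hAB hv)
    · exact dirSpan_apply_eq_zero hA h1 hv
  have := Submodule.finrank_sup_add_finrank_inf_eq (dirSpan σ₁) (dirSpan σ₂)
  rw [hinf, finrank_bot, add_zero] at this
  rw [sysDim, h, this, sysDim, sysDim]

theorem sysDim_const {S : Finset V} (hS : S.Nonempty) :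
    sysDim (fun _ : Finset V => S) = S.card - 1 := by
  have hli : LinearIndependent ℝ (fun i : V => (Pi.single i 1 : V → ℝ)) := by
    have := (Pi.basisFun ℝ V).linearIndependent
    simpa only [funext (Pi.basisFun_apply ℝ V)] using this
  have hai := hli.affineIndependent ℝ
  have hc : S.card = (S.card - 1) + 1 := by have := hS.card_pos; omega
  have := hai.finrank_vectorSpan_image_finset hc
  have hspan : dirSpan (fun _ : Finset V => S) =
      vectorSpan ℝ (Finset.image (fun i : V => (Pi.single i 1 : V → ℝ)) S : Set (V → ℝ)) := by
    rw [vectorSpan_def, dirSpan]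
    refine congrArg _ (Set.ext fun x => ?_)
    constructor
    · rintro ⟨I, i, hi, j, hj, rfl⟩
      exact ⟨_, by simpa using ⟨i, hi, rfl⟩, _, by simpa using ⟨j, hj, rfl⟩, rfl⟩
    · rintro ⟨a, ha, b, hb, rfl⟩
      simp only [Finset.coe_image, Set.mem_image, Finset.mem_coe] at ha hb
      obtain ⟨i, hi, rfl⟩ := ha
      obtain ⟨j, hj, rfl⟩ := hb
      exact ⟨∅, i, hi, j, hj, rfl⟩
  rw [sysDim, hspan, this]

open scoped Classical in
/-- The system on a connected set `U` with set of maximizers `S` on `U` and restriction `τ`. -/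
noncomputable def glueSystem (G : SimpleGraph V) (U S : Finset V) (τ : Finset V → Finset V) :
    Finset V → Finset V :=
  fun I => if I ⊆ U ∧ G.ConnOn I then (if (I ∩ S).Nonempty then I ∩ S else τ I) else ∅

/-- A connected set that meets the top set `argmaxOn w U` has all its maximizers there; any other
one lies in the complement. So the top set and the system on the complement determine everything. -/
theorem faceSystem_eq_glueSystem (G : SimpleGraph V) (U : Finset V) (w : V → ℝ) :
    faceSystem G U w =
      glueSystem G U (argmaxOn w U) (faceSystem G (U \ argmaxOn w U) w) := by
  funext I
  by_cases hI : I ⊆ U ∧ G.ConnOn I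
  · by_cases hS : (I ∩ argmaxOn w U).Nonempty
    · simp only [faceSystem, glueSystem, hI, hS, and_self, if_true]
      exact argmaxOn_inter hI.1 hS
    · have h2 : I ⊆ U \ argmaxOn w U := fun x hx => Finset.mem_sdiff.2
        ⟨hI.1 hx, fun h => hS ⟨x, Finset.mem_inter.2 ⟨hx, h⟩⟩⟩
      simp only [faceSystem, glueSystem, hI, hS, h2, and_self, if_true, if_false]
  · simp only [faceSystem, glueSystem, hI, if_false]

theorem sysDim_faceSystem {G : SimpleGraph V} {U : Finset V} (hU : G.ConnOn U) (w : V → ℝ) :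
    sysDim (faceSystem G U w) =
      (argmaxOn w U).card - 1 + sysDim (faceSystem G (U \ argmaxOn w U) w) := by
  rw [← sysDim_const (argmaxOn_nonempty w hU.1)]
  refine sysDim_eq_add (A := argmaxOn w U) (B := U \ argmaxOn w U) (fun _ => subset_rfl)
    (fun I => faceSystem_subset _ _ _ _) Finset.disjoint_sdiff (le_antisymm ?_ (sup_le ?_ ?_))
  · refine dirSpan_le fun I i hi j hj => ?_
    rw [faceSystem_eq_glueSystem] at hi hj
    unfold glueSystem at hi hj
    split_ifs at hi hj with h1 h2
    · exact Submodule.mem_sup_left (sub_mem_dirSpan (I := I) (Finset.mem_inter.1 hi).2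
        (Finset.mem_inter.1 hj).2)
    · exact Submodule.mem_sup_right (sub_mem_dirSpan hi hj)
    · simp at hi
  · refine dirSpan_le fun I i hi j hj => sub_mem_dirSpan (I := U) ?_ ?_ <;>
    simpa [faceSystem, hU]
  · refine dirSpan_le fun I i hi j hj => ?_
    unfold faceSystem at hi hj
    split_ifs at hi hj with h
    · refine sub_mem_dirSpan (I := I) ?_ ?_ <;>
      simpa [faceSystem, h.1.trans Finset.sdiff_subset, h.2]
    · simp at hi

/-- Raising `w₀` on `S` above its global maximum makes `S` the top set and leaves the weights
elsewhere alone. Hence every top set can be combined with every system on the rest. -/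
theorem exists_argmaxOn_eq (w₀ : V → ℝ) {U S : Finset V} (hS : S.Nonempty) (hSU : S ⊆ U) :
    ∃ w : V → ℝ, argmaxOn w U = S ∧ ∀ i ∉ S, w i = w₀ i := by
  obtain ⟨M, hM⟩ := (Set.toFinite (Set.range w₀)).bddAbove
  have hM' : ∀ i, w₀ i ≤ M := fun i => hM ⟨i, rfl⟩
  refine ⟨fun i => if i ∈ S then M + 1 else w₀ i, ?_, fun i hi => by simp [hi]⟩
  obtain ⟨s, hs⟩ := hS
  ext i
  rw [mem_argmaxOn]
  constructor
  · rintro ⟨_, h⟩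
    by_contra hi
    have := h s (hSU hs)
    simp only [hs, hi, if_true, if_false] at this
    linarith [hM' i]
  · refine fun hi => ⟨hSU hi, fun j _ => ?_⟩
    simp only [hi, if_true]
    split_ifs
    · exact le_rfl
    · linarith [hM' j]

theorem restrict_faceSystem (G : SimpleGraph V) {U U' : Finset V} (h : U' ⊆ U) (w : V → ℝ) :
    (fun I => if I ⊆ U' then faceSystem G U w I else ∅) = faceSystem G U' w := by
  funext I
  by_cases hI : I ⊆ U'
  · have hI' : I ⊆ U := hI.trans h
    by_cases hc : G.ConnOn I <;> simp [faceSystem, hI, hI', hc]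
  · simp [faceSystem, hI]

theorem faceSystem_self {G : SimpleGraph V} {U : Finset V} (hU : G.ConnOn U) (w : V → ℝ) :
    faceSystem G U w U = argmaxOn w U := by simp [faceSystem, hU]

/-- The `h`-polynomial of the graph-associahedron of the subgraph induced on `U`, at `x`. -/
noncomputable def hVal (G : SimpleGraph V) (U : Finset V) (x : ℝ) : ℝ :=
  ∑ σ ∈ faceSystems G U, (x - 1) ^ sysDim σ

/-- The dimension of the graph-associahedron of the subgraph induced on `U`. -/
noncomputable def assocDim (G : SimpleGraph V) (U : Finset V) : ℕ :=
  sysDim (faceSystem G U 0)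

theorem faceSystem_empty (G : SimpleGraph V) (w : V → ℝ) : faceSystem G ∅ w = fun _ => ∅ := by
  funext I
  have := faceSystem_subset G ∅ w I
  exact Finset.subset_empty.1 this

theorem sysDim_empty : sysDim (fun _ : Finset V => (∅ : Finset V)) = 0 := by
  have : dirSpan (fun _ : Finset V => (∅ : Finset V)) = ⊥ :=
    eq_bot_iff.2 (dirSpan_le fun I i hi => by simp at hi)
  rw [sysDim, this, finrank_bot]

theorem hVal_empty (G : SimpleGraph V) (x : ℝ) : hVal G ∅ x = 1 := by
  have : faceSystems G ∅ = {fun _ => ∅} := by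
    ext σ
    simp only [mem_faceSystems, faceSystem_empty, Finset.mem_singleton]
    exact ⟨fun ⟨_, h⟩ => h.symm, fun h => ⟨0, h.symm⟩⟩
  rw [hVal, this, Finset.sum_singleton, sysDim_empty, pow_zero]

theorem assocDim_empty (G : SimpleGraph V) : assocDim G ∅ = 0 := by
  rw [assocDim, faceSystem_empty, sysDim_empty]

theorem assocDim_of_connOn {G : SimpleGraph V} {U : Finset V} (hU : G.ConnOn U) :
    assocDim G U = U.card - 1 := by
  have : argmaxOn (0 : V → ℝ) U = U := by ext; simp [mem_argmaxOn]
  rw [assocDim, sysDim_faceSystem hU, this, Finset.sdiff_self, faceSystem_empty, sysDim_empty,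
    add_zero]

/-- Systems on a connected `U` correspond to pairs of a nonempty top set `S` and a system on `U \
S`; the top set contributes the dimension `S.card - 1` of a simplex. This recursion and `hVal_union`
are all that is used later about `hVal`. -/
theorem hVal_of_connOn {G : SimpleGraph V} {U : Finset V} (hU : G.ConnOn U) (x : ℝ) :
    hVal G U x =
      ∑ S ∈ U.powerset.filter (·.Nonempty), (x - 1) ^ (S.card - 1) * hVal G (U \ S) x := by
  have key : ∀ S τ, (⟨S, τ⟩ : Σ _ : Finset V, Finset V → Finset V) ∈
      (U.powerset.filter (·.Nonempty)).sigma (fun S => faceSystems G (U \ S)) →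
      ∃ w, argmaxOn w U = S ∧ faceSystem G (U \ S) w = τ := by
    intro S τ hp
    simp only [Finset.mem_sigma, Finset.mem_filter, Finset.mem_powerset, mem_faceSystems] at hp
    obtain ⟨⟨hSU, hS⟩, w₀, rfl⟩ := hp
    obtain ⟨w, hw, hw₀⟩ := exists_argmaxOn_eq w₀ hS hSU
    exact ⟨w, hw, faceSystem_congr fun i hi => hw₀ i (Finset.mem_sdiff.1 hi).2⟩
  simp only [hVal, Finset.mul_sum, ← pow_add]
  rw [Finset.sum_sigma']
  refine Finset.sum_bij'
    (fun σ _ => (⟨σ U, fun I => if I ⊆ U \ σ U then σ I else ∅⟩ :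
      Σ _ : Finset V, Finset V → Finset V))
    (fun p _ => glueSystem G U p.1 p.2) ?_ ?_ ?_ ?_ ?_
  · intro σ hσ
    obtain ⟨w, rfl⟩ := mem_faceSystems.1 hσ
    simp only [faceSystem_self hU, Finset.mem_sigma, Finset.mem_filter, Finset.mem_powerset]
    refine ⟨⟨argmaxOn_subset w U, argmaxOn_nonempty w hU.1⟩, mem_faceSystems.2 ⟨w, ?_⟩⟩
    exact (restrict_faceSystem G Finset.sdiff_subset w).symm
  · rintro ⟨S, τ⟩ hp
    obtain ⟨w, rfl, rfl⟩ := key S τ hp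
    exact mem_faceSystems.2 ⟨w, faceSystem_eq_glueSystem G U w⟩
  · intro σ hσ
    obtain ⟨w, rfl⟩ := mem_faceSystems.1 hσ
    simp only [faceSystem_self hU, restrict_faceSystem G Finset.sdiff_subset w]
    exact (faceSystem_eq_glueSystem G U w).symm
  · rintro ⟨S, τ⟩ hp
    obtain ⟨w, rfl, rfl⟩ := key S τ hp
    simp only [← faceSystem_eq_glueSystem, faceSystem_self hU,
      restrict_faceSystem G Finset.sdiff_subset w]
  · intro σ hσ
    obtain ⟨w, rfl⟩ := mem_faceSystems.1 hσ
    simp only [faceSystem_self hU, restrict_faceSystem G Finset.sdiff_subset w,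
      sysDim_faceSystem hU w]

theorem faceSystem_union {G : SimpleGraph V} {U₁ U₂ : Finset V} (hd : Disjoint U₁ U₂)
    (h : ∀ a ∈ U₁, ∀ b ∈ U₂, ¬ G.Adj a b) (w : V → ℝ) :
    faceSystem G (U₁ ∪ U₂) w = fun I => faceSystem G U₁ w I ∪ faceSystem G U₂ w I := by
  funext I
  by_cases hI : G.ConnOn I
  · by_cases h1 : I ⊆ U₁
    · have h2 : ¬ I ⊆ U₂ := fun h2 => by
        obtain ⟨x, hx⟩ := hI.1
        exact Finset.disjoint_left.1 hd (h1 hx) (h2 hx)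
      simp [faceSystem, hI, h1, h2, h1.trans Finset.subset_union_left]
    · by_cases h2 : I ⊆ U₂
      · simp [faceSystem, hI, h1, h2, h2.trans Finset.subset_union_right]
      · have h3 : ¬ I ⊆ U₁ ∪ U₂ := fun h3 => (hI.subset_or h3 h).elim h1 h2
        simp [faceSystem, h1, h2, h3]
  · simp [faceSystem, hI]

theorem sysDim_faceSystem_union {G : SimpleGraph V} {U₁ U₂ : Finset V} (hd : Disjoint U₁ U₂)
    (h : ∀ a ∈ U₁, ∀ b ∈ U₂, ¬ G.Adj a b) (w : V → ℝ) :
    sysDim (faceSystem G (U₁ ∪ U₂) w) =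
      sysDim (faceSystem G U₁ w) + sysDim (faceSystem G U₂ w) := by
  refine sysDim_eq_add (faceSystem_subset G U₁ w) (faceSystem_subset G U₂ w) hd
    (le_antisymm (dirSpan_le fun I i hi j hj => ?_) (sup_le ?_ ?_))
  · have h0 : faceSystem G U₁ w I = ∅ ∨ faceSystem G U₂ w I = ∅ := by
      by_cases hI : G.ConnOn I
      · by_cases h1 : I ⊆ U₁
        · have h2 : ¬ I ⊆ U₂ := fun h2 => by
            obtain ⟨x, hx⟩ := hI.1
            exact Finset.disjoint_left.1 hd (h1 hx) (h2 hx)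
          exact Or.inr (by simp [faceSystem, h2])
        · exact Or.inl (by simp [faceSystem, h1])
      · exact Or.inl (by simp [faceSystem, hI])
    rw [faceSystem_union hd h] at hi hj
    rcases h0 with h0 | h0 <;> simp only [h0, Finset.empty_union, Finset.union_empty] at hi hj
    · exact Submodule.mem_sup_right (sub_mem_dirSpan hi hj)
    · exact Submodule.mem_sup_left (sub_mem_dirSpan hi hj)
  · rw [faceSystem_union hd h]
    exact dirSpan_le fun I i hi j hj => sub_mem_dirSpan (I := I) (Finset.mem_union_left _ hi)
      (Finset.mem_union_left _ hj)
  · rw [faceSystem_union hd h]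
    exact dirSpan_le fun I i hi j hj => sub_mem_dirSpan (I := I) (Finset.mem_union_right _ hi)
      (Finset.mem_union_right _ hj)

theorem assocDim_union {G : SimpleGraph V} {U₁ U₂ : Finset V} (hd : Disjoint U₁ U₂)
    (h : ∀ a ∈ U₁, ∀ b ∈ U₂, ¬ G.Adj a b) :
    assocDim G (U₁ ∪ U₂) = assocDim G U₁ + assocDim G U₂ :=
  sysDim_faceSystem_union hd h 0

/-- A connected set lies on one side of the separation, and weights on the two sides can be chosen
independently; systems therefore form a product and dimensions add. -/
theorem hVal_union {G : SimpleGraph V} {U₁ U₂ : Finset V} (hd : Disjoint U₁ U₂)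
    (h : ∀ a ∈ U₁, ∀ b ∈ U₂, ¬ G.Adj a b) (x : ℝ) :
    hVal G (U₁ ∪ U₂) x = hVal G U₁ x * hVal G U₂ x := by
  have key : ∀ p ∈ faceSystems G U₁ ×ˢ faceSystems G U₂,
      ∃ w, faceSystem G U₁ w = p.1 ∧ faceSystem G U₂ w = p.2 := by
    rintro ⟨σ, τ⟩ hp
    simp only [Finset.mem_product, mem_faceSystems] at hp
    obtain ⟨⟨w₁, rfl⟩, w₂, rfl⟩ := hp
    refine ⟨fun i => if i ∈ U₁ then w₁ i else w₂ i, faceSystem_congr fun i hi => by simp [hi],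
      faceSystem_congr fun i hi => ?_⟩
    simp [Finset.disjoint_right.1 hd hi]
  rw [hVal, hVal, hVal, Finset.sum_mul_sum, ← Finset.sum_product']
  refine Finset.sum_bij' (fun σ _ => ((fun I => if I ⊆ U₁ then σ I else ∅),
    (fun I => if I ⊆ U₂ then σ I else ∅))) (fun p _ => fun I => p.1 I ∪ p.2 I) ?_ ?_ ?_ ?_ ?_
  · intro σ hσ
    obtain ⟨w, rfl⟩ := mem_faceSystems.1 hσ
    simp only [restrict_faceSystem G Finset.subset_union_left w,
      restrict_faceSystem G Finset.subset_union_right w, Finset.mem_product, mem_faceSystems]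
    exact ⟨⟨w, rfl⟩, w, rfl⟩
  · intro p hp
    obtain ⟨w, h1, h2⟩ := key p hp
    rw [← h1, ← h2]
    exact mem_faceSystems.2 ⟨w, faceSystem_union hd h w⟩
  · intro σ hσ
    obtain ⟨w, rfl⟩ := mem_faceSystems.1 hσ
    have h1 := restrict_faceSystem G (Finset.subset_union_left (s₁ := U₁) (s₂ := U₂)) w
    have h2 := restrict_faceSystem G (Finset.subset_union_right (s₁ := U₁) (s₂ := U₂)) w
    refine (funext fun I => ?_).trans (faceSystem_union hd h w).symm
    exact congrArg₂ (· ∪ ·) (congrFun h1 I) (congrFun h2 I)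
  · intro p hp
    obtain ⟨w, h1, h2⟩ := key p hp
    refine Prod.ext ?_ ?_
    · simp only [← h1, ← h2, ← congrFun (faceSystem_union hd h w)]
      exact restrict_faceSystem G Finset.subset_union_left w
    · simp only [← h1, ← h2, ← congrFun (faceSystem_union hd h w)]
      exact restrict_faceSystem G Finset.subset_union_right w
  · intro σ hσ
    obtain ⟨w, rfl⟩ := mem_faceSystems.1 hσ
    simp only [restrict_faceSystem G Finset.subset_union_left w,
      restrict_faceSystem G Finset.subset_union_right w, sysDim_faceSystem_union hd h w, pow_add]

end FaceSystems

/-! ### Reconnected complements and the deletion formula for `h` -/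

section Deletion

variable {V : Type*} [Fintype V] [DecidableEq V]

theorem exists_separation {G : SimpleGraph V} {U : Finset V} (hU : U.Nonempty)
    (h : ¬ G.ConnOn U) : ∃ U₁ U₂ : Finset V, U₁.Nonempty ∧ U₂.Nonempty ∧ Disjoint U₁ U₂ ∧
      U = U₁ ∪ U₂ ∧ ∀ a ∈ U₁, ∀ b ∈ U₂, ¬ G.Adj a b := by
  simp only [ConnOn, hU, true_and] at h
  push Not at h
  obtain ⟨A, hA, hA0, hAU, h⟩ := h
  refine ⟨A, U \ A, hA0, ?_, Finset.disjoint_sdiff, (Finset.union_sdiff_of_subset hA).symm, ?_⟩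
  · exact Finset.sdiff_nonempty.2 fun h => hAU (hA.antisymm h)
  · intro a ha b hb
    exact h a ha b (Finset.mem_sdiff.1 hb).1 (Finset.mem_sdiff.1 hb).2

theorem ConnOn.image {G G' : SimpleGraph V} (π : Equiv.Perm V) {U : Finset V}
    (h : ∀ a ∈ U, ∀ b ∈ U, G.Adj a b → G'.Adj (π a) (π b)) (hU : G.ConnOn U) :
    G'.ConnOn (U.image π) := by
  refine ⟨hU.1.image π, fun A hA hA0 hAU => ?_⟩
  have hAe : (A.image π.symm).image π = A := by simp [Finset.image_image]
  have hsub : A.image π.symm ⊆ U := by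
    intro x hx
    obtain ⟨y, hy, rfl⟩ := Finset.mem_image.1 hx
    obtain ⟨z, hz, rfl⟩ := Finset.mem_image.1 (hA hy)
    simpa using hz
  obtain ⟨a, ha, b, hb, hba, hab⟩ := hU.2 _ hsub (hA0.image _)
    (fun e => hAU (by rw [← hAe, e]))
  refine ⟨π a, ?_, π b, Finset.mem_image_of_mem _ hb, ?_, h a (hsub ha) b hb hab⟩
  · rw [← hAe]; exact Finset.mem_image_of_mem _ ha
  · intro hb'
    exact hba (by simpa using Finset.mem_image_of_mem π.symm hb')

/-- Both quantities are determined by the connected recursion and the rule for separated unions, and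
these are invariant under isomorphism; hence induction on the number of vertices. -/
theorem hVal_and_assocDim_image {G G' : SimpleGraph V} (π : Equiv.Perm V) {U : Finset V}
    (h : ∀ a ∈ U, ∀ b ∈ U, (G.Adj a b ↔ G'.Adj (π a) (π b))) :
    (∀ x, hVal G' (U.image π) x = hVal G U x) ∧ assocDim G' (U.image π) = assocDim G U := by
  induction hn : U.card using Nat.strong_induction_on generalizing U with
  | _ n ih =>
  subst hn
  rcases U.eq_empty_or_nonempty with rfl | hU0
  · simp [hVal_empty, assocDim_empty]
  by_cases hU : G.ConnOn U
  · have hU' : G'.ConnOn (U.image π) := hU.image π fun a ha b hb => (h a ha b hb).1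
    constructor
    · intro x
      rw [hVal_of_connOn hU, hVal_of_connOn hU']
      refine Finset.sum_bij' (fun S _ => S.image π.symm) (fun S _ => S.image π) ?_ ?_ ?_ ?_ ?_
      · intro S hS
        simp only [Finset.mem_filter, Finset.mem_powerset] at hS ⊢
        refine ⟨?_, hS.2.image _⟩
        have := Finset.image_subset_image (f := π.symm) hS.1
        simpa [Finset.image_image] using this
      · intro S hS
        simp only [Finset.mem_filter, Finset.mem_powerset] at hS ⊢
        exact ⟨Finset.image_subset_image hS.1, hS.2.image _⟩
      · intro S _; simp [Finset.image_image]
      · intro S _; simp [Finset.image_image]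
      · intro S hS
        simp only [Finset.mem_filter, Finset.mem_powerset] at hS
        have hSe : (S.image π.symm).image π = S := by simp [Finset.image_image]
        have hSU : S.image π.symm ⊆ U := by
          have := Finset.image_subset_image (f := π.symm) hS.1
          simpa [Finset.image_image] using this
        have h1 : U.image π \ S = (U \ S.image π.symm).image π := by
          rw [Finset.image_sdiff _ _ π.injective, hSe]
        have hlt : (U \ S.image π.symm).card < U.card := by
          refine Finset.card_lt_card (Finset.sdiff_ssubset hSU (hS.2.image _))
        rw [h1, (ih _ hlt (fun a ha b hb => h a (Finset.mem_sdiff.1 ha).1 b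
          (Finset.mem_sdiff.1 hb).1) rfl).1 x, Finset.card_image_of_injective _ π.symm.injective]
    · rw [assocDim_of_connOn hU, assocDim_of_connOn hU',
        Finset.card_image_of_injective _ π.injective]
  · obtain ⟨U₁, U₂, h1, h2, hd, rfl, hs⟩ := exists_separation hU0 hU
    have c := Finset.card_union_of_disjoint hd
    have i1 := ih U₁.card (by have := h2.card_pos; omega) (U := U₁) (fun a ha b hb =>
      h a (Finset.mem_union_left _ ha) b (Finset.mem_union_left _ hb)) rfl
    have i2 := ih U₂.card (by have := h1.card_pos; omega) (U := U₂) (fun a ha b hb =>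
      h a (Finset.mem_union_right _ ha) b (Finset.mem_union_right _ hb)) rfl
    have hd' : Disjoint (U₁.image π) (U₂.image π) :=
      (Finset.disjoint_image π.injective).2 hd
    have hs' : ∀ a ∈ U₁.image π, ∀ b ∈ U₂.image π, ¬ G'.Adj a b := by
      intro a' ha' b' hb'
      obtain ⟨a, ha, rfl⟩ := Finset.mem_image.1 ha'
      obtain ⟨b, hb, rfl⟩ := Finset.mem_image.1 hb'
      rw [← h a (Finset.mem_union_left _ ha) b (Finset.mem_union_right _ hb)]
      exact hs a ha b hb
    rw [Finset.image_union]
    refine ⟨fun x => ?_, ?_⟩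
    · rw [hVal_union hd' hs', hVal_union hd hs, i1.1, i2.1]
    · rw [assocDim_union hd' hs', assocDim_union hd hs, i1.2, i2.2]

theorem hVal_congr {G G' : SimpleGraph V} {U : Finset V}
    (h : ∀ a ∈ U, ∀ b ∈ U, (G.Adj a b ↔ G'.Adj a b)) (x : ℝ) : hVal G U x = hVal G' U x := by
  simpa using ((hVal_and_assocDim_image (Equiv.refl V) h).1 x).symm

theorem ConnOn.mono {G G' : SimpleGraph V} {U : Finset V}
    (h : ∀ a ∈ U, ∀ b ∈ U, G.Adj a b → G'.Adj a b) (hU : G.ConnOn U) : G'.ConnOn U := by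
  simpa using hU.image (Equiv.refl V) h

/-- The reconnected complement: delete `I`, join all neighbours of `I` with each other. -/
def contract (G : SimpleGraph V) (I : Finset V) : SimpleGraph V where
  Adj a b := a ≠ b ∧ (G.Adj a b ∨ (∃ i ∈ I, G.Adj i a) ∧ ∃ i ∈ I, G.Adj i b)
  symm := ⟨fun _ _ h => ⟨h.1.symm, h.2.imp (fun h => h.symm) fun h => ⟨h.2, h.1⟩⟩⟩
  loopless := ⟨fun _ h => h.1 rfl⟩

theorem contract_adj {G : SimpleGraph V} {I : Finset V} {a b : V} : (G.contract I).Adj a b ↔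
    a ≠ b ∧ (G.Adj a b ∨ (∃ i ∈ I, G.Adj i a) ∧ ∃ i ∈ I, G.Adj i b) := Iff.rfl

/-- If `U \ I` split into two parts, connectedness of `U` would force an edge from `I` into each
part, and contraction joins any two distinct neighbours of `I`. -/
theorem ConnOn.contract {G : SimpleGraph V} {U I : Finset V} (hU : G.ConnOn U) (hI : I ⊂ U) :
    (G.contract I).ConnOn (U \ I) := by
  by_contra hc
  obtain ⟨B₁, B₂, h1, h2, hd, he, hs⟩ :=
    exists_separation (Finset.sdiff_nonempty.2 hI.2) hc
  have key : ∀ B₁ B₂ : Finset V, B₁.Nonempty → Disjoint B₁ B₂ → B₁ ≠ U → U \ I = B₁ ∪ B₂ →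
      (∀ a ∈ B₁, ∀ b ∈ B₂, ¬ (G.contract I).Adj a b) → ∃ i ∈ I, ∃ a ∈ B₁, G.Adj i a := by
    intro B₁ B₂ h1 hd hne he hs
    have hsub : B₁ ⊆ U := fun x hx =>
      (Finset.mem_sdiff.1 (he ▸ Finset.mem_union_left _ hx)).1
    obtain ⟨a, ha, b, hb, hba, hab⟩ := hU.2 B₁ hsub h1 hne
    by_cases hbI : b ∈ I
    · exact ⟨b, hbI, a, ha, hab.symm⟩
    · have : b ∈ B₂ := by
        have : b ∈ B₁ ∪ B₂ := he ▸ Finset.mem_sdiff.2 ⟨hb, hbI⟩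
        exact (Finset.mem_union.1 this).resolve_left hba
      exact (hs a ha b this ⟨hab.ne, Or.inl hab⟩).elim
  have hne : ∀ B₁ B₂ : Finset V, B₂.Nonempty → Disjoint B₁ B₂ → U \ I = B₁ ∪ B₂ → B₁ ≠ U := by
    rintro B₁ B₂ ⟨x, hx⟩ hd he rfl
    have : x ∈ B₁ \ I := he ▸ Finset.mem_union_right _ hx
    exact Finset.disjoint_left.1 hd (Finset.mem_sdiff.1 this).1 hx
  have hs' : ∀ a ∈ B₂, ∀ b ∈ B₁, ¬ (G.contract I).Adj a b :=
    fun a ha b hb hab => hs b hb a ha hab.symm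
  have he' : U \ I = B₂ ∪ B₁ := by rw [he, Finset.union_comm]
  obtain ⟨i, hi, a, ha, hia⟩ := key B₁ B₂ h1 hd (hne _ _ h2 hd he) he hs
  obtain ⟨j, hj, b, hb, hjb⟩ := key B₂ B₁ h2 hd.symm (hne _ _ h1 hd.symm he') he' hs'
  exact hs a ha b hb ⟨fun e => Finset.disjoint_left.1 hd ha (e ▸ hb), Or.inr ⟨⟨i, hi, hia⟩, j, hj, hjb⟩⟩

open scoped Classical in
/-- The sets inside `U` that are connected in `G`, but not without the edge `uv`. -/
noncomputable def bridgedSets (G : SimpleGraph V) (u v : V) (U : Finset V) : Finset (Finset V) :=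
  U.powerset.filter fun I => G.ConnOn I ∧ ¬ (G.deleteEdges {s(u, v)}).ConnOn I

theorem mem_bridgedSets {G : SimpleGraph V} {u v : V} {U I : Finset V} :
    I ∈ bridgedSets G u v U ↔
      I ⊆ U ∧ G.ConnOn I ∧ ¬ (G.deleteEdges {s(u, v)}).ConnOn I := by
  simp [bridgedSets]

theorem adj_deleteEdge {G : SimpleGraph V} {u v a b : V} :
    (G.deleteEdges {s(u, v)}).Adj a b ↔ G.Adj a b ∧ ¬ (a = u ∧ b = v ∨ a = v ∧ b = u) := by
  simp [deleteEdges_adj]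

theorem adj_deleteEdge_of_notMem {G : SimpleGraph V} {u v a b : V} {U : Finset V}
    (h : ¬ (u ∈ U ∧ v ∈ U)) (ha : a ∈ U) (hb : b ∈ U) :
    (G.deleteEdges {s(u, v)}).Adj a b ↔ G.Adj a b := by
  rw [adj_deleteEdge, and_iff_left_iff_imp]
  rintro - (⟨rfl, rfl⟩ | ⟨rfl, rfl⟩)
  · exact h ⟨ha, hb⟩
  · exact h ⟨hb, ha⟩

theorem mem_of_mem_bridgedSets {G : SimpleGraph V} {u v : V} {U I : Finset V}
    (h : I ∈ bridgedSets G u v U) : u ∈ I ∧ v ∈ I := by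
  by_contra hc
  obtain ⟨-, h1, h2⟩ := mem_bridgedSets.1 h
  exact h2 (h1.mono fun a ha b hb => (adj_deleteEdge_of_notMem hc ha hb).2)

/-- Removing a bridge of a connected set leaves exactly two connected pieces. -/
theorem exists_bridge_separation {G : SimpleGraph V} {u v : V} {I : Finset V} (hI : G.ConnOn I)
    (hI' : ¬ (G.deleteEdges {s(u, v)}).ConnOn I) : ∃ U₁ U₂ : Finset V,
      (G.deleteEdges {s(u, v)}).ConnOn U₁ ∧ (G.deleteEdges {s(u, v)}).ConnOn U₂ ∧
      Disjoint U₁ U₂ ∧ I = U₁ ∪ U₂ ∧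
      ∀ a ∈ U₁, ∀ b ∈ U₂, ¬ (G.deleteEdges {s(u, v)}).Adj a b := by
  -- Only the deleted edge can cross a separation of `I`, so its ends lie on opposite sides.
  have key : ∀ U₁ U₂ : Finset V, U₁.Nonempty → U₂.Nonempty → Disjoint U₁ U₂ → I = U₁ ∪ U₂ →
      (∀ a ∈ U₁, ∀ b ∈ U₂, ¬ (G.deleteEdges {s(u, v)}).Adj a b) →
      (u ∈ U₁ ∧ v ∈ U₂ ∨ v ∈ U₁ ∧ u ∈ U₂) := by
    intro U₁ U₂ h1 h2 hd he hs
    obtain ⟨a, ha, b, hb, hba, hab⟩ := hI.2 U₁ (he ▸ Finset.subset_union_left) h1 (by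
      rintro rfl
      obtain ⟨x, hx⟩ := h2
      exact Finset.disjoint_left.1 hd (he ▸ Finset.mem_union_right _ hx) hx)
    have hb2 : b ∈ U₂ := (Finset.mem_union.1 (he ▸ hb)).resolve_left hba
    have := hs a ha b hb2
    rw [adj_deleteEdge] at this
    by_contra hc
    refine this ⟨hab, ?_⟩
    rintro (⟨rfl, rfl⟩ | ⟨rfl, rfl⟩)
    · exact hc (Or.inl ⟨ha, hb2⟩)
    · exact hc (Or.inr ⟨ha, hb2⟩)
  obtain ⟨U₁, U₂, h1, h2, hd, he, hs⟩ := exists_separation hI.1 hI'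
  -- If `U₁` split further into `A` and `B`, applying `key` to each of them against the rest would
  -- put the end of the edge in `U₁` into both.
  have conn : ∀ U₁ U₂ : Finset V, U₁.Nonempty → U₂.Nonempty → Disjoint U₁ U₂ → I = U₁ ∪ U₂ →
      (∀ a ∈ U₁, ∀ b ∈ U₂, ¬ (G.deleteEdges {s(u, v)}).Adj a b) →
      (G.deleteEdges {s(u, v)}).ConnOn U₁ := by
    intro U₁ U₂ h1 h2 hd he hs
    by_contra hc
    obtain ⟨A, B, hA, hB, hAB, rfl, hsAB⟩ := exists_separation h1 hc
    rw [Finset.disjoint_union_left] at hd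
    have hsep := fun a ha => hs a (Finset.mem_union_left B ha)
    have hsepB := fun a ha => hs a (Finset.mem_union_right A ha)
    have k0 := key _ _ h1 h2 (Finset.disjoint_union_left.2 hd) he hs
    have kA := key A (B ∪ U₂) hA (h2.mono Finset.subset_union_right)
      (Finset.disjoint_union_right.2 ⟨hAB, hd.1⟩) (by rw [he, Finset.union_assoc])
      (fun a ha b hb => (Finset.mem_union.1 hb).elim (hsAB a ha b) (hsep a ha b))
    have kB := key B (A ∪ U₂) hB (h2.mono Finset.subset_union_right)
      (Finset.disjoint_union_right.2 ⟨hAB.symm, hd.2⟩)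
      (by rw [he, Finset.union_left_comm, Finset.union_assoc])
      (fun b hb a ha => (Finset.mem_union.1 ha).elim (fun ha h => hsAB a ha b hb h.symm)
        (hsepB b hb a))
    have d1 := Finset.disjoint_left.1 hAB
    have d2 := Finset.disjoint_left.1 hd.1
    have d3 := Finset.disjoint_left.1 hd.2
    rcases k0 with ⟨-, h⟩ | ⟨-, h⟩
    · exact d1 (kA.resolve_right fun h' => d2 h'.1 h).1 (kB.resolve_right fun h' => d3 h'.1 h).1
    · exact d1 (kA.resolve_left fun h' => d2 h'.1 h).1 (kB.resolve_left fun h' => d3 h'.1 h).1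
  exact ⟨U₁, U₂, conn U₁ U₂ h1 h2 hd he hs, conn U₂ U₁ h2 h1 hd.symm
    (by rw [he, Finset.union_comm]) (fun a ha b hb h => hs b hb a ha h.symm), hd, he, hs⟩

theorem sum_powerset_eq_add {M : Type*} [AddCommMonoid M] (U : Finset V) (f : Finset V → M) :
    ∑ S ∈ U.powerset, f S = f ∅ + ∑ S ∈ U.powerset.filter (·.Nonempty), f S := by
  have : U.powerset.filter (·.Nonempty) = U.powerset.erase ∅ := by
    ext S
    simp [Finset.nonempty_iff_ne_empty, and_comm]
  rw [this, Finset.add_sum_erase _ _ (Finset.empty_mem_powerset U)]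

theorem sum_nonempty_of_connOn {G : SimpleGraph V} {U : Finset V} (hU : G.ConnOn U) (x : ℝ) :
    ∑ S ∈ U.powerset.filter (·.Nonempty), (x - 1) ^ S.card * hVal G (U \ S) x =
      (x - 1) * hVal G U x := by
  rw [hVal_of_connOn hU, Finset.mul_sum]
  refine Finset.sum_congr rfl fun S hS => ?_
  obtain ⟨n, hn⟩ : ∃ n, S.card = n + 1 :=
    ⟨S.card - 1, by have := (Finset.mem_filter.1 hS).2.card_pos; omega⟩
  rw [hn, Nat.add_sub_cancel, pow_succ]
  ring

/-- Allowing `S = ∅` makes the sum multiplicative over separated unions (`sum_powerset_union`), with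
one factor `x` for each connected piece. -/
theorem sum_powerset_of_connOn {G : SimpleGraph V} {U : Finset V} (hU : G.ConnOn U) (x : ℝ) :
    ∑ S ∈ U.powerset, (x - 1) ^ S.card * hVal G (U \ S) x = x * hVal G U x := by
  rw [sum_powerset_eq_add, sum_nonempty_of_connOn hU]
  simp
  ring

theorem sum_powerset_union {G : SimpleGraph V} {U₁ U₂ : Finset V} (hd : Disjoint U₁ U₂)
    (hs : ∀ a ∈ U₁, ∀ b ∈ U₂, ¬ G.Adj a b) (x : ℝ) :
    ∑ S ∈ (U₁ ∪ U₂).powerset, (x - 1) ^ S.card * hVal G ((U₁ ∪ U₂) \ S) x =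
      (∑ S ∈ U₁.powerset, (x - 1) ^ S.card * hVal G (U₁ \ S) x) *
        ∑ S ∈ U₂.powerset, (x - 1) ^ S.card * hVal G (U₂ \ S) x := by
  rw [Finset.sum_mul_sum, ← Finset.sum_product']
  have hd' := Finset.disjoint_left.1 hd
  refine Finset.sum_bij' (fun S _ => (S ∩ U₁, S ∩ U₂)) (fun p _ => p.1 ∪ p.2) ?_ ?_ ?_ ?_ ?_
  · intro S _
    simp [Finset.inter_subset_right]
  · intro p hp
    simp only [Finset.mem_product, Finset.mem_powerset] at hp ⊢
    exact Finset.union_subset_union hp.1 hp.2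
  · intro S hS
    rw [Finset.mem_powerset] at hS
    rw [← Finset.inter_union_distrib_left, Finset.inter_eq_left.2 hS]
  · intro p hp
    simp only [Finset.mem_product, Finset.mem_powerset] at hp
    refine Prod.ext (Finset.ext fun a => ?_) (Finset.ext fun a => ?_)
    all_goals
      simp only [Finset.mem_inter, Finset.mem_union]
      have := @hp.1 a; have := @hp.2 a; have := @hd' a
      tauto
  · intro S hS
    rw [Finset.mem_powerset] at hS
    have h1 : (U₁ ∪ U₂) \ S = (U₁ \ (S ∩ U₁)) ∪ (U₂ \ (S ∩ U₂)) := by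
      rw [Finset.union_sdiff_distrib]
      congr 1 <;> ext a <;> simp
    have h2 : S.card = (S ∩ U₁).card + (S ∩ U₂).card := by
      rw [← Finset.card_union_of_disjoint, ← Finset.inter_union_distrib_left,
        Finset.inter_eq_left.2 hS]
      exact Finset.disjoint_of_subset_left Finset.inter_subset_right
        (Finset.disjoint_of_subset_right Finset.inter_subset_right hd)
    rw [h1, h2, hVal_union (Finset.disjoint_of_subset_left Finset.sdiff_subset
      (Finset.disjoint_of_subset_right Finset.sdiff_subset hd)) (fun a ha b hb =>
        hs a (Finset.mem_sdiff.1 ha).1 b (Finset.mem_sdiff.1 hb).1), pow_add]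
    ring

theorem bridgedSets_union {G : SimpleGraph V} {u v : V} {U₁ U₂ : Finset V} (hd : Disjoint U₁ U₂)
    (hs : ∀ a ∈ U₁, ∀ b ∈ U₂, ¬ G.Adj a b) (hu : u ∈ U₁) :
    bridgedSets G u v (U₁ ∪ U₂) = bridgedSets G u v U₁ := by
  ext I
  constructor
  · intro h
    have hI := mem_bridgedSets.1 h
    refine mem_bridgedSets.2 ⟨(hI.2.1.subset_or hI.1 hs).resolve_right fun h2 => ?_, hI.2⟩
    exact Finset.disjoint_left.1 hd hu (h2 (mem_of_mem_bridgedSets h).1)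
  · intro h
    have hI := mem_bridgedSets.1 h
    exact mem_bridgedSets.2 ⟨hI.1.trans Finset.subset_union_left, hI.2⟩

/-- A separated part is not affected by a contraction in the other part. -/
theorem not_adj_contract {G : SimpleGraph V} {U₁ U₂ I : Finset V}
    (hs : ∀ a ∈ U₁, ∀ b ∈ U₂, ¬ G.Adj a b) (hI : I ⊆ U₁) :
    ∀ a ∈ U₁ \ I, ∀ b ∈ U₂, ¬ (G.contract I).Adj a b := by
  rintro a ha b hb ⟨-, h | ⟨-, i, hi, h⟩⟩
  · exact hs a (Finset.mem_sdiff.1 ha).1 b hb h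
  · exact hs i (hI hi) b hb h

theorem contract_adj_of_separated {G : SimpleGraph V} {U₁ U₂ I : Finset V}
    (hs : ∀ a ∈ U₁, ∀ b ∈ U₂, ¬ G.Adj a b) (hI : I ⊆ U₁) {a b : V} (hb : b ∈ U₂) :
    (G.contract I).Adj a b ↔ G.Adj a b := by
  rw [contract_adj]
  constructor
  · rintro ⟨-, h | ⟨-, i, hi, h⟩⟩
    · exact h
    · exact (hs i (hI hi) b hb h).elim
  · exact fun h => ⟨h.ne, Or.inl h⟩

theorem exists_separation_mem {G : SimpleGraph V} {U : Finset V} {u : V} (hu : u ∈ U)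
    (h : ¬ G.ConnOn U) : ∃ U₁ U₂ : Finset V, u ∈ U₁ ∧ U₂.Nonempty ∧ Disjoint U₁ U₂ ∧
      U = U₁ ∪ U₂ ∧ ∀ a ∈ U₁, ∀ b ∈ U₂, ¬ G.Adj a b := by
  obtain ⟨U₁, U₂, h1, h2, hd, rfl, hs⟩ := exists_separation ⟨u, hu⟩ h
  rcases Finset.mem_union.1 hu with h | h
  · exact ⟨U₁, U₂, h, h2, hd, rfl, hs⟩
  · exact ⟨U₂, U₁, h, h1, hd.symm, Finset.union_comm _ _, fun a ha b hb h => hs b hb a ha h.symm⟩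

/-- Deletion formula for the `h`-polynomial of a graph-associahedron. -/
theorem hVal_deleteEdge {G : SimpleGraph V} {u v : V} (U : Finset V) {x : ℝ}
    (hx : x ≠ 1) :
    hVal G U x = hVal (G.deleteEdges {s(u, v)}) U x + x * ∑ I ∈ bridgedSets G u v U,
      hVal (G.deleteEdges {s(u, v)}) I x * hVal (G.contract I) (U \ I) x := by
  induction hn : U.card using Nat.strong_induction_on generalizing U with
  | _ n ih =>
  subst hn
  by_cases huvU : ¬ (u ∈ U ∧ v ∈ U)
  · have : bridgedSets G u v U = ∅ := Finset.eq_empty_of_forall_notMem fun I hI =>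
      huvU ⟨(mem_bridgedSets.1 hI).1 (mem_of_mem_bridgedSets hI).1,
        (mem_bridgedSets.1 hI).1 (mem_of_mem_bridgedSets hI).2⟩
    rw [this, Finset.sum_empty, mul_zero, add_zero]
    exact hVal_congr (fun a ha b hb => (adj_deleteEdge_of_notMem huvU ha hb).symm) x
  rw [not_not] at huvU
  by_cases hU : G.ConnOn U
  swap
  · obtain ⟨U₁, U₂, hu, h2, hd, rfl, hs⟩ := exists_separation_mem huvU.1 hU
    have hs' : ∀ a ∈ U₁, ∀ b ∈ U₂, ¬ (G.deleteEdges {s(u, v)}).Adj a b :=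
      fun a ha b hb h => hs a ha b hb (adj_deleteEdge.1 h).1
    have c := Finset.card_union_of_disjoint hd
    have i1 := ih U₁.card (by have := h2.card_pos; omega) U₁ rfl
    have e2 : hVal (G.deleteEdges {s(u, v)}) U₂ x = hVal G U₂ x :=
      hVal_congr (fun a ha b hb => adj_deleteEdge_of_notMem
        (fun h => Finset.disjoint_left.1 hd hu h.1) ha hb) x
    rw [bridgedSets_union hd hs hu, hVal_union hd hs, hVal_union hd hs', e2, i1, add_mul, mul_assoc,
      Finset.sum_mul]
    congr 2
    refine Finset.sum_congr rfl fun I hI => ?_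
    have hI1 := (mem_bridgedSets.1 hI).1
    have e3 : (U₁ ∪ U₂) \ I = (U₁ \ I) ∪ U₂ := by
      rw [Finset.union_sdiff_distrib, Finset.sdiff_eq_self_of_disjoint
        (Finset.disjoint_of_subset_right hI1 hd.symm)]
    rw [e3, hVal_union (Finset.disjoint_of_subset_left Finset.sdiff_subset hd)
      (not_adj_contract hs hI1), mul_assoc,
      hVal_congr (fun a ha b hb => contract_adj_of_separated hs hI1 hb)]
  -- Multiplying by `x - 1` replaces the exponents `S.card - 1` of the recursion by `S.card`, which
  -- fits the powerset sums.
  have hx' : x - 1 ≠ 0 := sub_ne_zero.2 hx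
  apply mul_left_cancel₀ hx'
  -- Exchange the sums: `S` and `I` are disjoint, and for fixed `I ≠ U` the sum over `S` is the
  -- recursion for `G.contract I` on the connected set `U \ I`.
  have hT : ∑ S ∈ U.powerset.filter (·.Nonempty), (x - 1) ^ S.card *
        (∑ I ∈ bridgedSets G u v (U \ S),
          hVal (G.deleteEdges {s(u, v)}) I x * hVal (G.contract I) ((U \ S) \ I) x) =
      (x - 1) * ∑ I ∈ (bridgedSets G u v U).erase U,
        hVal (G.deleteEdges {s(u, v)}) I x * hVal (G.contract I) (U \ I) x := by
    simp only [Finset.mul_sum]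
    rw [Finset.sum_comm' (t' := (bridgedSets G u v U).erase U)
      (s' := fun I => (U \ I).powerset.filter (·.Nonempty))]
    · refine Finset.sum_congr rfl fun I hI => ?_
      obtain ⟨hne, hI⟩ := Finset.mem_erase.1 hI
      have hc := hU.contract (Finset.ssubset_iff_subset_ne.2 ⟨(mem_bridgedSets.1 hI).1, hne⟩)
      rw [mul_left_comm, ← sum_nonempty_of_connOn hc, Finset.mul_sum]
      refine Finset.sum_congr rfl fun S _ => ?_
      rw [sdiff_right_comm]
      ring
    · intro S I
      simp only [Finset.mem_filter, Finset.mem_powerset, mem_bridgedSets, Finset.mem_erase,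
        Finset.subset_sdiff]
      constructor
      · rintro ⟨⟨h1, h2⟩, ⟨h3, h4⟩, h5⟩
        refine ⟨⟨⟨h1, h4.symm⟩, h2⟩, ?_, h3, h5⟩
        rintro rfl
        obtain ⟨s, hs⟩ := h2
        exact Finset.disjoint_left.1 h4 (h1 hs) hs
      · rintro ⟨⟨⟨h1, h2⟩, h3⟩, h4, h5, h6⟩
        exact ⟨⟨h1, h3⟩, ⟨h5, h2.symm⟩, h6⟩
  have hG : (x - 1) * hVal G U x =
      (∑ S ∈ U.powerset.filter (·.Nonempty),
        (x - 1) ^ S.card * hVal (G.deleteEdges {s(u, v)}) (U \ S) x) +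
      x * ((x - 1) * ∑ I ∈ (bridgedSets G u v U).erase U,
        hVal (G.deleteEdges {s(u, v)}) I x * hVal (G.contract I) (U \ I) x) := by
    rw [← sum_nonempty_of_connOn hU, ← hT, Finset.mul_sum, ← Finset.sum_add_distrib]
    refine Finset.sum_congr rfl fun S hS => ?_
    simp only [Finset.mem_filter, Finset.mem_powerset] at hS
    rw [ih (U \ S).card (Finset.card_lt_card (Finset.sdiff_ssubset hS.1 hS.2)) _ rfl]
    ring
  rw [hG]
  by_cases hU' : (G.deleteEdges {s(u, v)}).ConnOn U
  · rw [sum_nonempty_of_connOn hU', Finset.erase_eq_of_notMem fun h =>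
      (mem_bridgedSets.1 h).2.2 hU']
    ring
  -- Two pieces give the full sum a factor `x ^ 2`, so its nonempty terms give `x ^ 2 - 1 = (x - 1)
  -- * (1 + x)`. The summand `1` is the deleted graph, the summand `x` is the term `I = U`.
  · obtain ⟨U₁, U₂, h1, h2, hd, he, hs⟩ := exists_bridge_separation hU hU'
    have hp := sum_powerset_union hd hs x
    rw [sum_powerset_of_connOn h1, sum_powerset_of_connOn h2, ← he, sum_powerset_eq_add] at hp
    have hm := hVal_union hd hs x
    rw [← he] at hm
    rw [← Finset.add_sum_erase _ _ (mem_bridgedSets.2 ⟨subset_rfl, hU, hU'⟩), Finset.sdiff_self,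
      hVal_empty]
    simp only [Finset.card_empty, pow_zero, one_mul, Finset.sdiff_empty] at hp
    linear_combination hp - (x ^ 2 ) * hm

end Deletion

/-! ### `γ`-polynomials with natural coefficients, deletion and monotonicity -/

section Gamma

/-- `h x = ∑ γ_i x^i (1 + x)^(d - 2 i)` for `x > 1`, where the `γ_i` are the coefficients of `g`. -/
def GammaAt (d : ℕ) (h : ℝ → ℝ) (g : ℕ[X]) : Prop :=
  2 * g.natDegree ≤ d ∧ ∀ x : ℝ, 1 < x → h x = (1 + x) ^ d * aeval (x / (1 + x) ^ 2) g

/-- On `x > 1` the substitution `x / (1 + x) ^ 2` is injective, since equal values give `(x - y) *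
(1 - x * y) = 0`. It therefore takes infinitely many values, which determine the polynomial. -/
theorem GammaAt.unique {d : ℕ} {h : ℝ → ℝ} {g g' : ℕ[X]} (hg : GammaAt d h g)
    (hg' : GammaAt d h g') : g = g' := by
  have hinj : Set.InjOn (fun x : ℝ => x / (1 + x) ^ 2) (Set.Ioi 1) := by
    intro x hx y hy hxy
    have hx' : (1 : ℝ) < x := hx
    have hy' : (1 : ℝ) < y := hy
    have h1 : x * (1 + y) ^ 2 = y * (1 + x) ^ 2 := by
      have : x / (1 + x) ^ 2 = y / (1 + y) ^ 2 := hxy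
      rwa [div_eq_div_iff (by positivity) (by positivity)] at this
    have h2 : (x - y) * (1 - x * y) = 0 := by linear_combination h1
    have h3 : 1 - x * y ≠ 0 := by nlinarith
    exact sub_eq_zero.1 ((mul_eq_zero.1 h2).resolve_right h3)
  have hinf : ((fun x : ℝ => x / (1 + x) ^ 2) '' Set.Ioi 1).Infinite :=
    (Set.Ioi_infinite 1).image hinj
  have hmap : g.map (algebraMap ℕ ℝ) = g'.map (algebraMap ℕ ℝ) := by
    refine Polynomial.eq_of_infinite_eval_eq _ _ (hinf.mono ?_)
    rintro _ ⟨x, hx, rfl⟩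
    have hx' : (1 : ℝ) < x := hx
    have h1 := (hg.2 x hx).symm.trans (hg'.2 x hx)
    have := mul_left_cancel₀ (by positivity) h1
    simpa [aeval_def, eval_map] using this
  exact Polynomial.map_injective _ (fun a b h => by simpa using h) hmap

theorem GammaAt.congr {d d' : ℕ} {h h' : ℝ → ℝ} {g : ℕ[X]} (hg : GammaAt d h g)
    (hd : d = d') (hh : ∀ x, 1 < x → h x = h' x) : GammaAt d' h' g := by
  subst hd
  exact ⟨hg.1, fun x hx => by rw [← hh x hx, hg.2 x hx]⟩

theorem gammaAt_one : GammaAt 0 (fun _ => 1) 1 := ⟨by simp, by simp⟩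

theorem gammaAt_zero (d : ℕ) : GammaAt d (fun _ => 0) 0 := ⟨by simp, by simp⟩

theorem GammaAt.add {d : ℕ} {h h' : ℝ → ℝ} {g g' : ℕ[X]} (hg : GammaAt d h g)
    (hg' : GammaAt d h' g') : GammaAt d (fun x => h x + h' x) (g + g') := by
  refine ⟨?_, fun x hx => by simp only [hg.2 x hx, hg'.2 x hx, map_add]; ring⟩
  have := natDegree_add_le g g'
  have := hg.1
  have := hg'.1
  omega

theorem GammaAt.mul {d d' : ℕ} {h h' : ℝ → ℝ} {g g' : ℕ[X]} (hg : GammaAt d h g)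
    (hg' : GammaAt d' h' g') : GammaAt (d + d') (fun x => h x * h' x) (g * g') := by
  refine ⟨?_, fun x hx => by simp only [hg.2 x hx, hg'.2 x hx, map_mul, pow_add]; ring⟩
  have := natDegree_mul_le (p := g) (q := g')
  have := hg.1
  have := hg'.1
  omega

/-- A factor `1 + x` is absorbed by the dimension; this is how a deletion that disconnects the graph
keeps its `γ`. -/
theorem GammaAt.succ {d : ℕ} {h : ℝ → ℝ} {g : ℕ[X]} (hg : GammaAt d h g) :
    GammaAt (d + 1) (fun x => (1 + x) * h x) g :=
  ⟨hg.1.trans (Nat.le_succ d), fun x hx => by simp only [hg.2 x hx, pow_succ]; ring⟩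

theorem GammaAt.X_mul {d : ℕ} {h : ℝ → ℝ} {g : ℕ[X]} (hg : GammaAt d h g) :
    GammaAt (d + 2) (fun x => x * h x) (X * g) := by
  refine ⟨?_, fun x hx => ?_⟩
  · have := natDegree_mul_le (p := (X : ℕ[X])) (q := g)
    have := natDegree_X_le (R := ℕ)
    have := hg.1
    omega
  · have : 1 + x ≠ 0 := by positivity
    simp only [hg.2 x hx, map_mul, aeval_X]
    field_simp
    ring

theorem GammaAt.sum {ι : Type*} {s : Finset ι} {d : ℕ} {h : ι → ℝ → ℝ} {g : ι → ℕ[X]}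
    (hg : ∀ i ∈ s, GammaAt d (h i) (g i)) :
    GammaAt d (fun x => ∑ i ∈ s, h i x) (∑ i ∈ s, g i) := by
  classical
  induction s using Finset.induction_on with
  | empty => simpa using gammaAt_zero d
  | insert a s ha ih =>
    simp only [Finset.sum_insert ha]
    exact (hg a (Finset.mem_insert_self _ _)).add
      (ih fun i hi => hg i (Finset.mem_insert_of_mem hi))

variable {V : Type*} [Fintype V] [DecidableEq V]

theorem assocDim_of_mem_bridgedSets {G : SimpleGraph V} {u v : V} {U I : Finset V}
    (hI : I ∈ bridgedSets G u v U) : assocDim (G.deleteEdges {s(u, v)}) I + 2 = I.card := by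
  obtain ⟨-, h, h'⟩ := mem_bridgedSets.1 hI
  obtain ⟨U₁, U₂, h1, h2, hd, rfl, hs⟩ := exists_bridge_separation h h'
  rw [assocDim_union hd hs, assocDim_of_connOn h1, assocDim_of_connOn h2,
    Finset.card_union_of_disjoint hd]
  have := h1.1.card_pos
  have := h2.1.card_pos
  omega

/-- For `I ≠ U` the factors have dimensions `I.card - 2` (two pieces) and `U.card - I.card - 1`,
together two less than `U.card - 1`; the factor `x` makes up for this and becomes `X`. The term `I =
U`, present exactly when the deletion disconnects `U`, combines with the deleted graph to a factor
`1 + x` and leaves `γ` unchanged. -/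
theorem gammaAt_deleteEdge {G : SimpleGraph V} {u v : V} {U : Finset V} (hU : G.ConnOn U)
    {g : ℕ[X]} {a b : Finset V → ℕ[X]}
    (hg : GammaAt (assocDim (G.deleteEdges {s(u, v)}) U) (hVal (G.deleteEdges {s(u, v)}) U) g)
    (ha : ∀ I ∈ (bridgedSets G u v U).erase U, GammaAt (assocDim (G.deleteEdges {s(u, v)}) I)
      (hVal (G.deleteEdges {s(u, v)}) I) (a I))
    (hb : ∀ I ∈ (bridgedSets G u v U).erase U, GammaAt (assocDim (G.contract I) (U \ I))
      (hVal (G.contract I) (U \ I)) (b I)) :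
    GammaAt (assocDim G U) (hVal G U)
      (g + X * ∑ I ∈ (bridgedSets G u v U).erase U, a I * b I) := by
  have hsum : ∀ I ∈ (bridgedSets G u v U).erase U, GammaAt (assocDim G U)
      (fun x => x * (hVal (G.deleteEdges {s(u, v)}) I x * hVal (G.contract I) (U \ I) x))
      (X * (a I * b I)) := by
    intro I hI
    refine ((ha I hI).mul (hb I hI)).X_mul.congr ?_ fun _ _ => rfl
    obtain ⟨hne, hI⟩ := Finset.mem_erase.1 hI
    have hss := Finset.ssubset_iff_subset_ne.2 ⟨(mem_bridgedSets.1 hI).1, hne⟩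
    have h1 := assocDim_of_mem_bridgedSets hI
    rw [assocDim_of_connOn (hU.contract hss), assocDim_of_connOn hU,
      Finset.card_sdiff_of_subset hss.1]
    have := Finset.card_lt_card hss
    omega
  rw [Finset.mul_sum]
  by_cases hU' : (G.deleteEdges {s(u, v)}).ConnOn U
  · refine ((hg.congr ?_ fun _ _ => rfl).add (GammaAt.sum hsum)).congr rfl fun x hx => ?_
    · rw [assocDim_of_connOn hU', assocDim_of_connOn hU]
    · rw [hVal_deleteEdge (G := G) (u := u) (v := v) U hx.ne', ← Finset.mul_sum,
        Finset.erase_eq_of_notMem fun h => (mem_bridgedSets.1 h).2.2 hU']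
  · have hmem : U ∈ bridgedSets G u v U := mem_bridgedSets.2 ⟨subset_rfl, hU, hU'⟩
    refine ((hg.succ.congr ?_ fun _ _ => rfl).add (GammaAt.sum hsum)).congr rfl fun x hx => ?_
    · have := assocDim_of_mem_bridgedSets hmem
      rw [assocDim_of_connOn hU]
      omega
    · rw [hVal_deleteEdge (G := G) (u := u) (v := v) U hx.ne', ← Finset.mul_sum,
        ← Finset.add_sum_erase _ _ hmem, Finset.sdiff_self, hVal_empty]
      ring

theorem ncard_edgeSet_deleteEdge_lt {G : SimpleGraph V} {u v : V} (h : G.Adj u v) :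
    (G.deleteEdges {s(u, v)}).edgeSet.ncard < G.edgeSet.ncard := by
  refine Set.ncard_lt_ncard ?_ (Set.toFinite _)
  rw [edgeSet_deleteEdges]
  exact ⟨Set.sdiff_subset, fun hc => (hc (a := s(u, v)) h).2 rfl⟩

theorem hVal_singleton (G : SimpleGraph V) (a : V) (x : ℝ) : hVal G {a} x = 1 := by
  have hc : G.ConnOn {a} := ⟨Finset.singleton_nonempty a, fun A hA hA0 hne =>
    ((Finset.subset_singleton_iff.1 hA).elim hA0.ne_empty hne).elim⟩
  have : ({a} : Finset V).powerset.filter (·.Nonempty) = {{a}} := by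
    ext S
    simp only [Finset.mem_filter, Finset.mem_powerset, Finset.subset_singleton_iff,
      Finset.mem_singleton]
    constructor
    · rintro ⟨rfl | h, h0⟩
      · simp at h0
      · exact h
    · rintro rfl
      exact ⟨Or.inr rfl, Finset.singleton_nonempty a⟩
  rw [hVal_of_connOn hc, this]
  simp [hVal_empty]

/-- The induction is on the number of vertices first and edges second: contraction may create edges
but loses vertices, while deletion keeps `U` and loses an edge. -/
theorem exists_gammaAt (G : SimpleGraph V) (U : Finset V) :
    ∃ g, GammaAt (assocDim G U) (hVal G U) g := by
  induction hn : U.card using Nat.strong_induction_on generalizing U G with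
  | _ n ih =>
  subst hn
  induction hm : G.edgeSet.ncard using Nat.strong_induction_on generalizing G with
  | _ m ihm =>
  subst hm
  rcases U.eq_empty_or_nonempty with rfl | hU0
  · exact ⟨1, gammaAt_one.congr (assocDim_empty G).symm fun x _ => (hVal_empty G x).symm⟩
  by_cases hU : G.ConnOn U
  · by_cases he : ∃ u v, u ∈ U ∧ v ∈ U ∧ G.Adj u v
    · obtain ⟨u, v, -, -, huv⟩ := he
      obtain ⟨g, hg⟩ := ihm _ (ncard_edgeSet_deleteEdge_lt huv) _ rfl
      have ha : ∀ I : Finset V, ∃ a, I ∈ (bridgedSets G u v U).erase U →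
          GammaAt (assocDim (G.deleteEdges {s(u, v)}) I)
            (hVal (G.deleteEdges {s(u, v)}) I) a := by
        intro I
        by_cases hI : I ∈ (bridgedSets G u v U).erase U
        · obtain ⟨hne, hI⟩ := Finset.mem_erase.1 hI
          have hss := Finset.ssubset_iff_subset_ne.2 ⟨(mem_bridgedSets.1 hI).1, hne⟩
          obtain ⟨a, ha⟩ := ih _ (Finset.card_lt_card hss) (G.deleteEdges {s(u, v)}) I rfl
          exact ⟨a, fun _ => ha⟩
        · exact ⟨0, fun h => (hI h).elim⟩
      have hb : ∀ I : Finset V, ∃ b, I ∈ (bridgedSets G u v U).erase U →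
          GammaAt (assocDim (G.contract I) (U \ I)) (hVal (G.contract I) (U \ I)) b := by
        intro I
        by_cases hI : I ∈ (bridgedSets G u v U).erase U
        · have hI' := mem_bridgedSets.1 (Finset.mem_erase.1 hI).2
          obtain ⟨b, hb⟩ := ih _ (Finset.card_lt_card (Finset.sdiff_ssubset hI'.1 hI'.2.1.1))
            (G.contract I) (U \ I) rfl
          exact ⟨b, fun _ => hb⟩
        · exact ⟨0, fun h => (hI h).elim⟩
      choose a ha using ha
      choose b hb using hb
      exact ⟨_, gammaAt_deleteEdge hU hg ha hb⟩
    · obtain ⟨a, ha⟩ := hU0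
      have : U = {a} := by
        by_contra hne
        obtain ⟨x, hx, y, hy, -, hxy⟩ := hU.2 {a} (Finset.singleton_subset_iff.2 ha)
          (Finset.singleton_nonempty a) (Ne.symm hne)
        rw [Finset.mem_singleton.1 hx] at hxy
        exact he ⟨a, y, ha, hy, hxy⟩
      subst this
      exact ⟨1, gammaAt_one.congr (by rw [assocDim_of_connOn hU]; simp)
        fun x _ => (hVal_singleton G a x).symm⟩
  · obtain ⟨U₁, U₂, h1, h2, hd, rfl, hs⟩ := exists_separation hU0 hU
    have c := Finset.card_union_of_disjoint hd
    obtain ⟨g₁, hg₁⟩ := ih U₁.card (by have := h2.card_pos; omega) G U₁ rfl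
    obtain ⟨g₂, hg₂⟩ := ih U₂.card (by have := h1.card_pos; omega) G U₂ rfl
    exact ⟨g₁ * g₂, (hg₁.mul hg₂).congr (assocDim_union hd hs).symm
      fun x _ => (hVal_union hd hs x).symm⟩

/-- The `γ`-polynomial of the graph-associahedron of the subgraph induced on `U`. -/
noncomputable def graphGamma (G : SimpleGraph V) (U : Finset V) : ℕ[X] :=
  (exists_gammaAt G U).choose

theorem graphGamma_spec (G : SimpleGraph V) (U : Finset V) :
    GammaAt (assocDim G U) (hVal G U) (graphGamma G U) := (exists_gammaAt G U).choose_spec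

theorem graphGamma_eq {G : SimpleGraph V} {U : Finset V} {g : ℕ[X]}
    (h : GammaAt (assocDim G U) (hVal G U) g) : graphGamma G U = g :=
  (graphGamma_spec G U).unique h

theorem graphGamma_image {G G' : SimpleGraph V} (π : Equiv.Perm V) {U : Finset V}
    (h : ∀ a ∈ U, ∀ b ∈ U, (G.Adj a b ↔ G'.Adj (π a) (π b))) :
    graphGamma G' (U.image π) = graphGamma G U := by
  obtain ⟨h1, h2⟩ := hVal_and_assocDim_image π h
  exact graphGamma_eq ((graphGamma_spec G U).congr h2.symm fun x _ => (h1 x).symm)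

theorem graphGamma_congr {G G' : SimpleGraph V} {U : Finset V}
    (h : ∀ a ∈ U, ∀ b ∈ U, (G.Adj a b ↔ G'.Adj a b)) : graphGamma G U = graphGamma G' U := by
  simpa using (graphGamma_image (Equiv.refl V) h).symm

theorem graphGamma_union {G : SimpleGraph V} {U₁ U₂ : Finset V} (hd : Disjoint U₁ U₂)
    (hs : ∀ a ∈ U₁, ∀ b ∈ U₂, ¬ G.Adj a b) :
    graphGamma G (U₁ ∪ U₂) = graphGamma G U₁ * graphGamma G U₂ :=
  graphGamma_eq (((graphGamma_spec G U₁).mul (graphGamma_spec G U₂)).congr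
    (assocDim_union hd hs).symm fun x _ => (hVal_union hd hs x).symm)

open scoped Classical in
/-- The members of `bridgedSets` that are not connected components of the subgraph on `U`. -/
noncomputable def innerBridgedSets (G : SimpleGraph V) (u v : V) (U : Finset V) :
    Finset (Finset V) :=
  (bridgedSets G u v U).filter fun I => ∃ i ∈ I, ∃ j ∈ U \ I, G.Adj i j

theorem mem_innerBridgedSets {G : SimpleGraph V} {u v : V} {U I : Finset V} :
    I ∈ innerBridgedSets G u v U ↔
      I ∈ bridgedSets G u v U ∧ ∃ i ∈ I, ∃ j ∈ U \ I, G.Adj i j := by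
  simp [innerBridgedSets]

/-- Deletion formula for the `γ`-polynomial of a graph-associahedron. -/
theorem graphGamma_deleteEdge (G : SimpleGraph V) (u v : V) (U : Finset V) :
    graphGamma G U = graphGamma (G.deleteEdges {s(u, v)}) U +
      X * ∑ I ∈ innerBridgedSets G u v U,
        graphGamma (G.deleteEdges {s(u, v)}) I * graphGamma (G.contract I) (U \ I) := by
  induction hn : U.card using Nat.strong_induction_on generalizing U with
  | _ n ih =>
  subst hn
  by_cases huU : u ∈ U
  swap
  · have : innerBridgedSets G u v U = ∅ := Finset.eq_empty_of_forall_notMem fun I hI =>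
      huU ((mem_bridgedSets.1 (mem_innerBridgedSets.1 hI).1).1
        (mem_of_mem_bridgedSets (mem_innerBridgedSets.1 hI).1).1)
    rw [this, Finset.sum_empty, mul_zero, add_zero]
    exact graphGamma_congr fun a ha b hb =>
      (adj_deleteEdge_of_notMem (fun h => huU h.1) ha hb).symm
  by_cases hU : G.ConnOn U
  -- In a connected `U` every proper nonempty subset has an edge to its complement, so only `I = U`
  -- is dropped.
  · have : innerBridgedSets G u v U = (bridgedSets G u v U).erase U := by
      ext I
      rw [mem_innerBridgedSets, Finset.mem_erase, and_comm]
      refine and_congr_left fun hI => ⟨?_, fun hne => ?_⟩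
      · rintro ⟨i, hi, j, hj, -⟩ rfl
        simp at hj
      · have hI := mem_bridgedSets.1 hI
        obtain ⟨a, ha, b, hb, hba, hab⟩ := hU.2 I hI.1 hI.2.1.1 hne
        exact ⟨a, ha, b, Finset.mem_sdiff.2 ⟨hb, hba⟩, hab⟩
    rw [this]
    exact graphGamma_eq (gammaAt_deleteEdge hU (graphGamma_spec _ _)
      (fun I _ => graphGamma_spec _ _) (fun I _ => graphGamma_spec _ _))
  · obtain ⟨U₁, U₂, hu, h2, hd, rfl, hs⟩ := exists_separation_mem huU hU
    have hs' : ∀ a ∈ U₁, ∀ b ∈ U₂, ¬ (G.deleteEdges {s(u, v)}).Adj a b :=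
      fun a ha b hb h => hs a ha b hb (adj_deleteEdge.1 h).1
    have c := Finset.card_union_of_disjoint hd
    have i1 := ih U₁.card (by have := h2.card_pos; omega) U₁ rfl
    have e2 : graphGamma (G.deleteEdges {s(u, v)}) U₂ = graphGamma G U₂ :=
      graphGamma_congr fun a ha b hb => adj_deleteEdge_of_notMem
        (fun h => Finset.disjoint_left.1 hd hu h.1) ha hb
    have e3 : innerBridgedSets G u v (U₁ ∪ U₂) = innerBridgedSets G u v U₁ := by
      ext I
      rw [mem_innerBridgedSets, mem_innerBridgedSets, bridgedSets_union hd hs hu]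
      refine and_congr_right fun hI => ⟨?_, ?_⟩
      · rintro ⟨i, hi, j, hj, hij⟩
        rw [Finset.mem_sdiff, Finset.mem_union] at hj
        exact ⟨i, hi, j, Finset.mem_sdiff.2 ⟨hj.1.resolve_right fun h =>
          hs i ((mem_bridgedSets.1 hI).1 hi) j h hij, hj.2⟩, hij⟩
      · rintro ⟨i, hi, j, hj, hij⟩
        rw [Finset.mem_sdiff] at hj
        exact ⟨i, hi, j, Finset.mem_sdiff.2 ⟨Finset.mem_union_left _ hj.1, hj.2⟩, hij⟩
    rw [e3, graphGamma_union hd hs, graphGamma_union hd hs', e2, i1, add_mul, mul_assoc,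
      Finset.sum_mul]
    congr 2
    refine Finset.sum_congr rfl fun I hI => ?_
    have hI1 := (mem_bridgedSets.1 (mem_innerBridgedSets.1 hI).1).1
    have e3 : (U₁ ∪ U₂) \ I = (U₁ \ I) ∪ U₂ := by
      rw [Finset.union_sdiff_distrib, Finset.sdiff_eq_self_of_disjoint
        (Finset.disjoint_of_subset_right hI1 hd.symm)]
    rw [e3, graphGamma_union (Finset.disjoint_of_subset_left Finset.sdiff_subset hd)
      (not_adj_contract hs hI1), mul_assoc,
      graphGamma_congr (fun a ha b hb => contract_adj_of_separated hs hI1 hb)]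

/-- Coefficientwise order on polynomials with natural coefficients. -/
def CoeffLE (p q : ℕ[X]) : Prop := ∃ r, q = p + r

theorem CoeffLE.refl (p : ℕ[X]) : CoeffLE p p := ⟨0, by simp⟩

theorem CoeffLE.trans {p q r : ℕ[X]} (h : CoeffLE p q) (h' : CoeffLE q r) : CoeffLE p r := by
  obtain ⟨a, rfl⟩ := h
  obtain ⟨b, rfl⟩ := h'
  exact ⟨a + b, by ring⟩

theorem CoeffLE.add {p q p' q' : ℕ[X]} (h : CoeffLE p q) (h' : CoeffLE p' q') :
    CoeffLE (p + p') (q + q') := by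
  obtain ⟨a, rfl⟩ := h
  obtain ⟨b, rfl⟩ := h'
  exact ⟨a + b, by ring⟩

theorem CoeffLE.mul {p q p' q' : ℕ[X]} (h : CoeffLE p q) (h' : CoeffLE p' q') :
    CoeffLE (p * p') (q * q') := by
  obtain ⟨a, rfl⟩ := h
  obtain ⟨b, rfl⟩ := h'
  exact ⟨a * p' + p * b + a * b, by ring⟩

theorem CoeffLE.sum {ι : Type*} {s t : Finset ι} {p q : ι → ℕ[X]} (hst : s ⊆ t)
    (h : ∀ i ∈ s, CoeffLE (p i) (q i)) : CoeffLE (∑ i ∈ s, p i) (∑ i ∈ t, q i) := by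
  classical
  refine CoeffLE.trans (q := ∑ i ∈ s, q i) ?_
    ⟨∑ i ∈ t \ s, q i, by rw [add_comm, Finset.sum_sdiff hst]⟩
  clear hst
  induction s using Finset.induction_on with
  | empty => simpa using CoeffLE.refl 0
  | insert a s ha ih =>
    simp only [Finset.sum_insert ha]
    exact (h a (Finset.mem_insert_self _ _)).add
      (ih fun i hi => h i (Finset.mem_insert_of_mem hi))

theorem graphGamma_deleteEdge_le (G : SimpleGraph V) (u v : V) (U : Finset V) :
    CoeffLE (graphGamma (G.deleteEdges {s(u, v)}) U) (graphGamma G U) :=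
  ⟨_, graphGamma_deleteEdge G u v U⟩

/-- Remove the surplus edges one at a time; each deletion loses a polynomial with natural
coefficients. -/
theorem graphGamma_mono_of_le {H G : SimpleGraph V} (h : H ≤ G) (U : Finset V) :
    CoeffLE (graphGamma H U) (graphGamma G U) := by
  induction hm : G.edgeSet.ncard using Nat.strong_induction_on generalizing G with
  | _ m ihm =>
  subst hm
  by_cases hle : G ≤ H
  · rw [le_antisymm h hle]
    exact CoeffLE.refl _
  · obtain ⟨u, v, huv, huv'⟩ : ∃ u v, G.Adj u v ∧ ¬ H.Adj u v := by
      by_contra! hc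
      exact hle fun u v => hc u v
    refine (ihm _ (ncard_edgeSet_deleteEdge_lt huv) (fun a b hab => ?_) rfl).trans
      (graphGamma_deleteEdge_le G u v U)
    rw [adj_deleteEdge]
    refine ⟨h hab, ?_⟩
    rintro (⟨rfl, rfl⟩ | ⟨rfl, rfl⟩)
    · exact huv' hab
    · exact huv' hab.symm

/-- The `γ`-polynomial is monotone in the edges inside `U`. -/
theorem graphGamma_mono {H G : SimpleGraph V} {U : Finset V}
    (h : ∀ a ∈ U, ∀ b ∈ U, H.Adj a b → G.Adj a b) :
    CoeffLE (graphGamma H U) (graphGamma G U) := by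
  -- Adding the edges of `H` changes nothing inside `U` and gives a comparison of whole graphs.
  have : graphGamma G U = graphGamma (G ⊔ H) U := graphGamma_congr fun a ha b hb => by
    rw [sup_adj]
    exact ⟨Or.inl, fun h' => h'.elim id (h a ha b hb)⟩
  rw [this]
  exact graphGamma_mono_of_le le_sup_right U

end Gamma

/-! ### Moving a separate graph from the root of a path to its end -/

section Shift

variable {V : Type*} [Fintype V] [DecidableEq V]

/-- Join the vertex `q` with all vertices in `N`. -/
def attach (H : SimpleGraph V) (N : Finset V) (q : V) : SimpleGraph V where
  Adj a b := a ≠ b ∧ (H.Adj a b ∨ a = q ∧ b ∈ N ∨ b = q ∧ a ∈ N)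
  symm := ⟨fun _ _ h => ⟨h.1.symm, h.2.imp (fun h => h.symm) Or.symm⟩⟩
  loopless := ⟨fun _ h => h.1 rfl⟩

theorem attach_adj {H : SimpleGraph V} {N : Finset V} {q a b : V} : (H.attach N q).Adj a b ↔
    a ≠ b ∧ (H.Adj a b ∨ a = q ∧ b ∈ N ∨ b = q ∧ a ∈ N) := Iff.rfl

theorem le_attach (H : SimpleGraph V) (N : Finset V) (q : V) : H ≤ H.attach N q :=
  fun _ _ h => ⟨h.ne, Or.inl h⟩

theorem attach_deleteEdge {H : SimpleGraph V} {N : Finset V} {q u v : V} (hu : u ∉ N)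
    (hv : v ∉ N) :
    (H.attach N q).deleteEdges {s(u, v)} = (H.deleteEdges {s(u, v)}).attach N q := by
  ext a b
  rw [adj_deleteEdge, attach_adj, attach_adj, adj_deleteEdge]
  constructor
  · rintro ⟨⟨h0, h | h⟩, h'⟩
    · exact ⟨h0, Or.inl ⟨h, h'⟩⟩
    · exact ⟨h0, Or.inr h⟩
  · rintro ⟨h0, h | h⟩
    · exact ⟨⟨h0, Or.inl h.1⟩, h.2⟩
    · refine ⟨⟨h0, Or.inr h⟩, ?_⟩
      rintro (⟨rfl, rfl⟩ | ⟨rfl, rfl⟩) <;> tauto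

theorem attach_contract {H : SimpleGraph V} {N I : Finset V} {q : V} (hq : q ∉ I)
    (hN : Disjoint N I) : (H.attach N q).contract I = (H.contract I).attach N q := by
  have key : ∀ a, (∃ i ∈ I, (H.attach N q).Adj i a) ↔ ∃ i ∈ I, H.Adj i a := by
    intro a
    constructor
    · rintro ⟨i, hi, -, h | ⟨rfl, -⟩ | ⟨-, h⟩⟩
      · exact ⟨i, hi, h⟩
      · exact (hq hi).elim
      · exact (Finset.disjoint_left.1 hN h hi).elim
    · rintro ⟨i, hi, h⟩
      exact ⟨i, hi, le_attach H N q h⟩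
  ext a b
  rw [contract_adj, attach_adj, attach_adj, contract_adj, key, key]
  constructor
  · rintro ⟨h0, ⟨-, h | h⟩ | h⟩
    · exact ⟨h0, Or.inl ⟨h0, Or.inl h⟩⟩
    · exact ⟨h0, Or.inr h⟩
    · exact ⟨h0, Or.inl ⟨h0, Or.inr h⟩⟩
  · rintro ⟨h0, ⟨-, h | h⟩ | h⟩
    · exact ⟨h0, Or.inl ⟨h0, Or.inl h⟩⟩
    · exact ⟨h0, Or.inr h⟩
    · exact ⟨h0, Or.inl ⟨h0, Or.inr h⟩⟩

/-- A cut not crossed by `H` has `q` and `q'` on the same side, so an edge from `q` to `N` that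
crosses it can be replaced by the edge from `q'`. -/
theorem ConnOn.attach_of_forall {H : SimpleGraph V} {N I : Finset V} {q q' : V} (hq : q ∈ I)
    (hq' : q' ∈ I)
    (h : ∀ B ⊆ I, (∀ a ∈ B, ∀ b ∈ I, b ∉ B → ¬ H.Adj a b) → (q ∈ B ↔ q' ∈ B))
    (hI : (H.attach N q).ConnOn I) : (H.attach N q').ConnOn I := by
  refine ⟨hI.1, fun B hB hB0 hBI => ?_⟩
  by_contra! hc
  have hH : ∀ a ∈ B, ∀ b ∈ I, b ∉ B → ¬ H.Adj a b :=
    fun a ha b hb hbB hab => hc a ha b hb hbB (le_attach H N q' hab)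
  have hqq := h B hB hH
  obtain ⟨a, ha, b, hb, hbB, -, hab | ⟨rfl, hbN⟩ | ⟨rfl, haN⟩⟩ := hI.2 B hB hB0 hBI
  · exact hH a ha b hb hbB hab
  · have := hqq.1 ha
    exact hc q' this b hb hbB ⟨fun e => hbB (e ▸ this), Or.inr (Or.inl ⟨rfl, hbN⟩)⟩
  · have : q' ∉ B := fun h => hbB (hqq.2 h)
    exact hc a ha q' hq' this ⟨fun e => this (e ▸ ha), Or.inr (Or.inr ⟨rfl, haN⟩)⟩

/-- The vertices of the path `p 0, …, p m`. -/
def pathSet (p : ℕ → V) (m : ℕ) : Finset V := (Finset.range (m + 1)).image p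

theorem mem_pathSet {p : ℕ → V} {m : ℕ} {a : V} : a ∈ pathSet p m ↔ ∃ i ≤ m, p i = a := by
  simp [pathSet]

/-- A graph `A`, a path `p 0, …, p m` that meets `A` in `p 0`, and a separate graph `F` with a
set `N` of vertices that can be attached to either end of the path. -/
structure ShiftConfig (H : SimpleGraph V) (A F N : Finset V) (m : ℕ) (p : ℕ → V) : Prop where
  root : p 0 ∈ A
  sub : N ⊆ F
  disj : Disjoint A F
  inj : ∀ i ≤ m, ∀ j ≤ m, p i = p j → i = j
  notMem : ∀ i ≤ m, 1 ≤ i → p i ∉ A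
  notMem_right : ∀ i ≤ m, p i ∉ F
  adj : ∀ i < m, H.Adj (p i) (p (i + 1))
  sep : ∀ a ∈ A ∪ pathSet p m, ∀ b ∈ F, ¬ H.Adj a b
  path_root : ∀ i ≤ m, 1 ≤ i → ∀ a ∈ A, H.Adj (p i) a → i = 1 ∧ a = p 0
  path_path : ∀ j ≤ m, ∀ i < j, H.Adj (p i) (p j) → j = i + 1

namespace ShiftConfig

variable {H : SimpleGraph V} {A F N : Finset V} {m : ℕ} {p : ℕ → V}

theorem mem_path {i : ℕ} (hi : i ≤ m) : p i ∈ A ∪ pathSet p m ∪ F :=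
  Finset.mem_union_left _ (Finset.mem_union_right _ (mem_pathSet.2 ⟨i, hi, rfl⟩))

theorem deleteEdge (h : ShiftConfig H A F N m p) {u v : V} (hu : u ∈ A) (hv : v ∈ A) :
    ShiftConfig (H.deleteEdges {s(u, v)}) A F N m p where
  __ := h
  adj i hi := by
    refine adj_deleteEdge.2 ⟨h.adj i hi, ?_⟩
    rintro (⟨-, h'⟩ | ⟨-, h'⟩) <;> exact h.notMem (i + 1) hi (by omega) (h' ▸ ‹_›)
  sep a ha b hb hab := h.sep a ha b hb (adj_deleteEdge.1 hab).1
  path_root i hi hi1 a ha hab := h.path_root i hi hi1 a ha (adj_deleteEdge.1 hab).1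
  path_path j hj i hi hab := h.path_path j hj i hi (adj_deleteEdge.1 hab).1

theorem restrict (h : ShiftConfig H A F N m p) {I : Finset V} (hI : p 0 ∈ I) :
    ShiftConfig H (A ∩ I) (F ∩ I) (N ∩ I) m p where
  root := Finset.mem_inter.2 ⟨h.root, hI⟩
  sub := Finset.inter_subset_inter_right h.sub
  disj := Finset.disjoint_of_subset_left Finset.inter_subset_left
    (Finset.disjoint_of_subset_right Finset.inter_subset_left h.disj)
  inj := h.inj
  notMem i hi hi1 hA := h.notMem i hi hi1 (Finset.mem_inter.1 hA).1
  notMem_right i hi hF := h.notMem_right i hi (Finset.mem_inter.1 hF).1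
  adj := h.adj
  sep a ha b hb := h.sep a (Finset.union_subset_union_left Finset.inter_subset_left ha) b
    (Finset.mem_inter.1 hb).1
  path_root i hi hi1 a ha := h.path_root i hi hi1 a (Finset.mem_inter.1 ha).1
  path_path := h.path_path

/-- A set that is connected after the shift and meets `A` contains an initial segment of the
path. -/
theorem mem_of_le (h : ShiftConfig H A F N m p) {I : Finset V} {u : V} (hu : u ∈ A)
    (huI : u ∈ I) (hIU : I ⊆ A ∪ pathSet p m ∪ F) (hI : (H.attach N (p m)).ConnOn I) {i j : ℕ}
    (hi : i ≤ m) (hj : j ≤ i) (hpi : p i ∈ I) : p j ∈ I := by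
  by_contra hpj
  have hji : j < i := lt_of_le_of_ne hj fun e => hpj (e ▸ hpi)
  -- The cut consists of what lies beyond `p j`: later path vertices and `F`. In the shifted graph,
  -- within the ambient set, an edge can leave it only to `p j`.
  have hB : ∀ x, x ∈ I.filter (fun x => (∃ t ≤ m, j < t ∧ p t = x) ∨ x ∈ F) ↔
      x ∈ I ∧ ((∃ t ≤ m, j < t ∧ p t = x) ∨ x ∈ F) := fun x => Finset.mem_filter
  obtain ⟨a, ha, b, hb, hbB, hab⟩ := hI.2 _ (Finset.filter_subset _ I)
    ⟨p i, (hB _).2 ⟨hpi, Or.inl ⟨i, hi, hji, rfl⟩⟩⟩ (fun e => by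
      rcases ((hB u).1 (by rw [e]; exact huI)).2 with ⟨t, ht, hjt, rfl⟩ | huF
      · exact h.notMem t ht (by omega) hu
      · exact Finset.disjoint_left.1 h.disj hu huF)
  rw [hB] at ha hbB
  have hbB' : ¬ ((∃ t ≤ m, j < t ∧ p t = b) ∨ b ∈ F) := fun h => hbB ⟨hb, h⟩
  have hbU := (Finset.mem_union.1 (hIU hb)).resolve_right fun h => hbB' (Or.inr h)
  obtain ⟨-, hab | ⟨rfl, hbN⟩ | ⟨rfl, haN⟩⟩ := hab
  · rcases ha.2 with ⟨t, ht, hjt, rfl⟩ | haF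
    · rcases Finset.mem_union.1 hbU with hbA | hbP
      · obtain ⟨rfl, rfl⟩ := h.path_root t ht (by omega) b hbA hab
        have : j = 0 := by omega
        exact hpj (this ▸ hb)
      · obtain ⟨t', ht', rfl⟩ := mem_pathSet.1 hbP
        have h1 : t' ≤ j := by
          by_contra hc
          exact hbB' (Or.inl ⟨t', ht', by omega, rfl⟩)
        have := h.path_path t ht t' (by omega) hab.symm
        have : t' = j := by omega
        exact hpj (this ▸ hb)
    · exact h.sep b hbU a haF hab.symm
  · exact hbB' (Or.inr (h.sub hbN))
  · exact hbB' (Or.inl ⟨m, le_rfl, by omega, rfl⟩)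

/-- After the shift, `F` is linked to the other vertices of the configuration only through `p m`. -/
theorem last_mem (h : ShiftConfig H A F N m p) {I : Finset V} {u x : V} (hu : u ∈ A)
    (huI : u ∈ I) (hIU : I ⊆ A ∪ pathSet p m ∪ F) (hI : (H.attach N (p m)).ConnOn I)
    (hx : x ∈ I) (hxF : x ∈ F) : p m ∈ I := by
  obtain ⟨a, ha, b, hb, hbB, hab⟩ := hI.2 (I ∩ F) Finset.inter_subset_left
    ⟨x, Finset.mem_inter.2 ⟨hx, hxF⟩⟩ (fun e =>
      Finset.disjoint_left.1 h.disj hu (Finset.inter_eq_left.1 e huI))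
  rw [Finset.mem_inter] at ha hbB
  have hbF : b ∉ F := fun h => hbB ⟨hb, h⟩
  obtain ⟨-, hab | ⟨rfl, hbN⟩ | ⟨rfl, haN⟩⟩ := hab
  · exact (h.sep b ((Finset.mem_union.1 (hIU hb)).resolve_right hbF) a ha.2 hab.symm).elim
  · exact ha.1
  · exact hb

/-- If all of the path lies in `I`, it does not matter for the connectivity of `I` to which end
of the path `N` is attached. -/
theorem connOn_attach_iff (h : ShiftConfig H A F N m p) {I : Finset V} (hI : ∀ i ≤ m, p i ∈ I) :
    (H.attach N (p m)).ConnOn I ↔ (H.attach N (p 0)).ConnOn I := by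
  have key : ∀ B ⊆ I, (∀ a ∈ B, ∀ b ∈ I, b ∉ B → ¬ H.Adj a b) →
      ∀ i ≤ m, (p i ∈ B ↔ p 0 ∈ B) := by
    intro B _ hB i
    induction i with
    | zero => simp
    | succ i ih =>
      intro hi
      rw [← ih (by omega)]
      constructor <;> intro h1 <;> by_contra h2
      · exact hB _ h1 _ (hI i (by omega)) h2 (h.adj i (by omega)).symm
      · exact hB _ h1 _ (hI (i + 1) hi) h2 (h.adj i (by omega))
  exact ⟨ConnOn.attach_of_forall (hI m le_rfl) (hI 0 (Nat.zero_le m))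
      fun B hB hB' => key B hB hB' m le_rfl,
    ConnOn.attach_of_forall (hI 0 (Nat.zero_le m)) (hI m le_rfl)
      fun B hB hB' => (key B hB hB' m le_rfl).symm⟩

theorem attach_adj_of_disjoint {I : Finset V} {q a b : V} (hI : Disjoint N I) (ha : a ∈ I)
    (hb : b ∈ I) : (H.attach N q).Adj a b ↔ H.Adj a b := by
  have h1 : a ∉ N := fun h => Finset.disjoint_left.1 hI h ha
  have h2 : b ∉ N := fun h => Finset.disjoint_left.1 hI h hb
  simp only [attach_adj, h1, h2, and_false, or_false]
  exact ⟨fun h => h.2, fun h => ⟨h.ne, h⟩⟩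

/-- The path touches `A` only at `p 0`, so contracting a part of `A` without the root creates no
edges at later path vertices and none at `F`. -/
theorem contract_of_root_notMem (h : ShiftConfig H A F N m p) {I : Finset V} (hIA : I ⊆ A)
    (hI : p 0 ∉ I) : ShiftConfig (H.contract I) (A \ I) F N m p where
  root := Finset.mem_sdiff.2 ⟨h.root, hI⟩
  sub := h.sub
  disj := Finset.disjoint_of_subset_left Finset.sdiff_subset h.disj
  inj := h.inj
  notMem i hi hi1 hA := h.notMem i hi hi1 (Finset.mem_sdiff.1 hA).1
  notMem_right := h.notMem_right
  adj i hi := ⟨(h.adj i hi).ne, Or.inl (h.adj i hi)⟩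
  sep a ha b hb hab := by
    obtain ⟨-, hab | ⟨-, k, hk, hkb⟩⟩ := hab
    · exact h.sep a (Finset.union_subset_union_left Finset.sdiff_subset ha) b hb hab
    · exact h.sep k (Finset.mem_union_left _ (hIA hk)) b hb hkb
  path_root i hi hi1 a ha hab := by
    obtain ⟨-, hab | ⟨⟨k, hk, hkb⟩, -⟩⟩ := hab
    · exact h.path_root i hi hi1 a (Finset.mem_sdiff.1 ha).1 hab
    · exact (hI ((h.path_root i hi hi1 k (hIA hk) hkb.symm).2 ▸ hk)).elim
  path_path j hj i hi hab := by
    obtain ⟨-, hab | ⟨-, k, hk, hkb⟩⟩ := hab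
    · exact h.path_path j hj i hi hab
    · exact (hI ((h.path_root j hj (by omega) k (hIA hk) hkb.symm).2 ▸ hk)).elim

theorem not_adj_segment (h : ShiftConfig H A F N m p) {I : Finset V}
    (hIU : I ⊆ A ∪ pathSet p m) {s : ℕ} (hs : 1 ≤ s) (hI : ∀ i ≤ m, (p i ∈ I ↔ i < s)) {t : ℕ}
    (ht : s < t) (htm : t ≤ m) {k : V} (hk : k ∈ I) : ¬ H.Adj k (p t) := by
  intro hkt
  rcases Finset.mem_union.1 (hIU hk) with hkA | hkP
  · have := (h.path_root t htm (by omega) k hkA hkt.symm).1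
    omega
  · obtain ⟨i, hi, rfl⟩ := mem_pathSet.1 hkP
    have := (hI i hi).1 hk
    have := h.path_path t htm i (by omega) hkt
    omega

/-- After `p 0, …, p (s - 1)` is swallowed, `p s` is the only remaining path vertex that can be a
neighbour of `I`. It is taken into the new graph `A` as its root, and the path becomes shorter by
`s`. -/
theorem contract_of_segment (h : ShiftConfig H A F N m p) {I : Finset V}
    (hIU : I ⊆ A ∪ pathSet p m) {s : ℕ} (hs : 1 ≤ s) (hsm : s ≤ m)
    (hI : ∀ i ≤ m, (p i ∈ I ↔ i < s)) :
    ShiftConfig (H.contract I) (insert (p s) (A \ I)) F N (m - s) (fun i => p (s + i)) where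
  root := Finset.mem_insert_self _ _
  sub := h.sub
  disj := by
    rw [Finset.disjoint_insert_left]
    exact ⟨h.notMem_right s hsm, Finset.disjoint_of_subset_left Finset.sdiff_subset h.disj⟩
  inj i hi j hj hij := by
    have := h.inj (s + i) (by omega) (s + j) (by omega) hij
    omega
  notMem i hi hi1 hA := by
    rcases Finset.mem_insert.1 hA with hA | hA
    · have := h.inj (s + i) (by omega) s hsm hA
      omega
    · exact h.notMem (s + i) (by omega) (by omega) (Finset.mem_sdiff.1 hA).1
  notMem_right i hi := h.notMem_right (s + i) (by omega)
  adj i hi := by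
    have := h.adj (s + i) (by omega)
    exact ⟨this.ne, Or.inl this⟩
  sep a ha b hb hab := by
    obtain ⟨-, hab | ⟨-, k, hk, hkb⟩⟩ := hab
    · refine h.sep a ?_ b hb hab
      rcases Finset.mem_union.1 ha with ha | ha
      · rcases Finset.mem_insert.1 ha with rfl | ha
        · exact Finset.mem_union_right _ (mem_pathSet.2 ⟨s, hsm, rfl⟩)
        · exact Finset.mem_union_left _ (Finset.mem_sdiff.1 ha).1
      · obtain ⟨i, hi, rfl⟩ := mem_pathSet.1 ha
        exact Finset.mem_union_right _ (mem_pathSet.2 ⟨s + i, by omega, rfl⟩)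
    · exact h.sep k (hIU hk) b hb hkb
  path_root i hi hi1 a ha hab := by
    obtain ⟨-, hab | ⟨⟨k, hk, hkb⟩, -⟩⟩ := hab
    · rcases Finset.mem_insert.1 ha with rfl | ha
      · have := h.path_path (s + i) (by omega) s (by omega) hab.symm
        exact ⟨by omega, rfl⟩
      · have := (h.path_root (s + i) (by omega) (by omega) a (Finset.mem_sdiff.1 ha).1 hab).1
        omega
    · exact (h.not_adj_segment hIU hs hI (by omega) (by omega) hk hkb).elim
  path_path j hj i hi hab := by
    obtain ⟨-, hab | ⟨-, k, hk, hkb⟩⟩ := hab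
    · have := h.path_path (s + j) (by omega) (s + i) (by omega) hab
      omega
    · exact (h.not_adj_segment hIU hs hI (by omega) (by omega) hk hkb).elim

/-- The reversal of the path. -/
noncomputable def reverse (p : ℕ → V) (m : ℕ) (x : V) : V :=
  open scoped Classical in if h : ∃ i ≤ m, p i = x then p (m - h.choose) else x

theorem reverse_path (h : ShiftConfig H A F N m p) {i : ℕ} (hi : i ≤ m) :
    reverse p m (p i) = p (m - i) := by
  have he : ∃ j ≤ m, p j = p i := ⟨i, hi, rfl⟩
  rw [reverse, dif_pos he, h.inj _ he.choose_spec.1 i hi he.choose_spec.2]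

theorem reverse_of_ne {x : V} (hx : ∀ i ≤ m, p i ≠ x) : reverse p m x = x := by
  rw [reverse, dif_neg]
  rintro ⟨i, hi, h⟩
  exact hx i hi h

theorem reverse_involutive (h : ShiftConfig H A F N m p) :
    Function.Involutive (reverse p m) := by
  intro x
  by_cases hx : ∃ i ≤ m, p i = x
  · obtain ⟨i, hi, rfl⟩ := hx
    rw [h.reverse_path hi, h.reverse_path (Nat.sub_le m i), Nat.sub_sub_self hi]
  · have hx' : ∀ i ≤ m, p i ≠ x := fun i hi e => hx ⟨i, hi, e⟩
    rw [reverse_of_ne hx', reverse_of_ne hx']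

theorem reverse_mem (h : ShiftConfig H A F N m p) {x : V} (hx : x ∈ A ∪ pathSet p m ∪ F) :
    reverse p m x ∈ A ∪ pathSet p m ∪ F := by
  by_cases hx' : ∃ i ≤ m, p i = x
  · obtain ⟨i, hi, rfl⟩ := hx'
    rw [h.reverse_path hi]
    exact mem_path (Nat.sub_le m i)
  · rwa [reverse_of_ne fun i hi e => hx' ⟨i, hi, e⟩]

/-- Without edges in `A`, the edges of the configuration are those of the path, which reversal
permutes, and those inside `F`, which it fixes. -/
theorem adj_reverse (h : ShiftConfig H A F N m p) (hA : ∀ a ∈ A, ∀ b ∈ A, ¬ H.Adj a b)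
    {a b : V} (ha : a ∈ A ∪ pathSet p m ∪ F) (hb : b ∈ A ∪ pathSet p m ∪ F) (hab : H.Adj a b) :
    H.Adj (reverse p m a) (reverse p m b) := by
  have hpath : ∀ i ≤ m, ∀ j ≤ m, i < j → H.Adj (p i) (p j) →
      H.Adj (reverse p m (p i)) (reverse p m (p j)) := by
    intro i hi j hj hij hadj
    have := h.path_path j hj i hij hadj
    subst this
    rw [h.reverse_path hi, h.reverse_path hj]
    have := (h.adj (m - (i + 1)) (by omega)).symm
    rwa [show m - (i + 1) + 1 = m - i by omega] at this
  have hpath' : ∀ a ∈ A ∪ pathSet p m, ∀ i ≤ m, H.Adj a (p i) → ∃ j ≤ m, p j = a := by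
    intro a ha i hi hadj
    rcases Finset.mem_union.1 ha with ha | ha
    · rcases Nat.eq_zero_or_pos i with rfl | hi0
      · exact (hA a ha _ h.root hadj).elim
      · exact ⟨0, Nat.zero_le m, (h.path_root i hi hi0 a ha hadj.symm).2.symm⟩
    · exact mem_pathSet.1 ha
  have hne : ∀ x ∈ F, ∀ i ≤ m, p i ≠ x := fun x hx i hi e => h.notMem_right i hi (e ▸ hx)
  rcases Finset.mem_union.1 ha with ha | ha <;> rcases Finset.mem_union.1 hb with hb | hb
  · have hex : ∃ i ≤ m, p i = a := by
      rcases Finset.mem_union.1 hb with hbA | hbP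
      · rcases Finset.mem_union.1 ha with haA | haP
        · exact (hA a haA b hbA hab).elim
        · exact mem_pathSet.1 haP
      · obtain ⟨i, hi, rfl⟩ := mem_pathSet.1 hbP
        exact hpath' a ha i hi hab
    obtain ⟨i, hi, rfl⟩ := hex
    obtain ⟨j, hj, rfl⟩ := hpath' b hb i hi hab.symm
    rcases lt_trichotomy i j with hij | rfl | hij
    · exact hpath i hi j hj hij hab
    · exact (hab.ne rfl).elim
    · exact (hpath j hj i hi hij hab.symm).symm
  · exact (h.sep a ha b hb hab).elim
  · exact (h.sep b hb a ha hab.symm).elim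
  · rwa [reverse_of_ne (hne a ha), reverse_of_ne (hne b hb)]

/-- If `A` has no edges, the shift is the reversal of the path. -/
theorem graphGamma_eq_of_forall_not_adj (h : ShiftConfig H A F N m p)
    (hA : ∀ a ∈ A, ∀ b ∈ A, ¬ H.Adj a b) :
    graphGamma (H.attach N (p m)) (A ∪ pathSet p m ∪ F) =
      graphGamma (H.attach N (p 0)) (A ∪ pathSet p m ∪ F) := by
  have hinv := h.reverse_involutive
  have key : ∀ q, ∀ a ∈ A ∪ pathSet p m ∪ F, ∀ b ∈ A ∪ pathSet p m ∪ F,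
      (H.attach N q).Adj a b →
        (H.attach N (reverse p m q)).Adj (reverse p m a) (reverse p m b) := by
    have hN : ∀ x ∈ N, reverse p m x = x := fun x hx =>
      reverse_of_ne fun i hi e => h.notMem_right i hi (h.sub (e ▸ hx))
    rintro q a ha b hb ⟨h0, hab | ⟨rfl, hbN⟩ | ⟨rfl, haN⟩⟩
    · exact le_attach _ _ _ (h.adj_reverse hA ha hb hab)
    · exact ⟨hinv.injective.ne h0, Or.inr (Or.inl ⟨rfl, (hN b hbN).symm ▸ hbN⟩)⟩
    · exact ⟨hinv.injective.ne h0, Or.inr (Or.inr ⟨rfl, (hN a haN).symm ▸ haN⟩)⟩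
  have h0 : reverse p m (p m) = p 0 := by rw [h.reverse_path le_rfl, Nat.sub_self]
  have hm : reverse p m (p 0) = p m := by rw [h.reverse_path (Nat.zero_le m), Nat.sub_zero]
  have himg : (A ∪ pathSet p m ∪ F).image hinv.toPerm = A ∪ pathSet p m ∪ F := by
    ext x
    rw [Finset.mem_image]
    constructor
    · rintro ⟨y, hy, rfl⟩
      exact h.reverse_mem hy
    · exact fun hx => ⟨_, h.reverse_mem hx, hinv x⟩
  rw [← graphGamma_image (G := H.attach N (p m)) (G' := H.attach N (p 0)) hinv.toPerm, himg]
  intro a ha b hb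
  simp only [Function.Involutive.coe_toPerm]
  constructor
  · exact fun hab => h0 ▸ key (p m) a ha b hb hab
  · intro hab
    have := key (p 0) _ (h.reverse_mem ha) _ (h.reverse_mem hb) hab
    rwa [hm, hinv a, hinv b] at this

/-- Since `I` contains `u ∈ A`, meeting `N` forces it to contain the whole path, and then the place
of attachment does not affect connectivity. If it misses `N`, the attached edges play no role inside
`I`. An outgoing edge from `p m` to `N` is replaced by the one from `p 0`, which also lies in `I`.
-/
theorem innerBridgedSets_subset (h : ShiftConfig H A F N m p) {u v : V} (hu : u ∈ A)
    (hv : v ∈ A) :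
    innerBridgedSets (H.attach N (p m)) u v (A ∪ pathSet p m ∪ F) ⊆
      innerBridgedSets (H.attach N (p 0)) u v (A ∪ pathSet p m ∪ F) := by
  intro I hI
  obtain ⟨hIb, i, hi, j, hj, hij⟩ := mem_innerBridgedSets.1 hI
  obtain ⟨hIU, hIc, hIn⟩ := mem_bridgedSets.1 hIb
  have huI := (mem_of_mem_bridgedSets hIb).1
  have hlast : ∀ x ∈ I, x ∈ F → p m ∈ I := fun x => h.last_mem hu huI hIU hIc
  have hpath : p m ∈ I → ∀ i ≤ m, p i ∈ I :=
    fun hm i hi => h.mem_of_le hu huI hIU hIc le_rfl hi hm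
  have huN : u ∉ N := fun hN => Finset.disjoint_left.1 h.disj hu (h.sub hN)
  have hvN : v ∉ N := fun hN => Finset.disjoint_left.1 h.disj hv (h.sub hN)
  refine mem_innerBridgedSets.2 ⟨mem_bridgedSets.2 ⟨hIU, ?_⟩, ?_⟩
  · rw [attach_deleteEdge huN hvN] at hIn ⊢
    by_cases hF : Disjoint N I
    · exact ⟨hIc.mono fun a ha b hb hab => (attach_adj_of_disjoint hF ha hb).2
          ((attach_adj_of_disjoint hF ha hb).1 hab),
        fun hc => hIn (hc.mono fun a ha b hb hab => (attach_adj_of_disjoint hF ha hb).2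
          ((attach_adj_of_disjoint hF ha hb).1 hab))⟩
    · obtain ⟨x, hxN, hxI⟩ := Finset.not_disjoint_iff.1 hF
      have hall := hpath (hlast x hxI (h.sub hxN))
      exact ⟨(h.connOn_attach_iff hall).1 hIc,
        fun hc => hIn (((h.deleteEdge hu hv).connOn_attach_iff hall).2 hc)⟩
  · obtain ⟨-, hij | ⟨rfl, hjN⟩ | ⟨rfl, hiN⟩⟩ := hij
    · exact ⟨i, hi, j, hj, le_attach _ _ _ hij⟩
    · refine ⟨p 0, hpath hi 0 (Nat.zero_le m), j, hj, fun e => ?_, Or.inr (Or.inl ⟨rfl, hjN⟩)⟩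
      exact h.notMem_right 0 (Nat.zero_le m) (e ▸ h.sub hjN)
    · exact ((Finset.mem_sdiff.1 hj).2 (hlast i hi (h.sub hiN))).elim

/-- Moving a separate graph from the root of a path to its other end does not increase the
`γ`-polynomial. -/
theorem graphGamma_le (h : ShiftConfig H A F N m p) :
    CoeffLE (graphGamma (H.attach N (p m)) (A ∪ pathSet p m ∪ F))
      (graphGamma (H.attach N (p 0)) (A ∪ pathSet p m ∪ F)) := by
  -- Outer induction on a bound for the number of vertices, for contractions; inner induction on the
  -- edges of `H`, for the deleted graph and its restriction to `I`.
  obtain ⟨n, hn⟩ : ∃ n, (A ∪ pathSet p m ∪ F).card < n := ⟨_, Nat.lt_succ_self _⟩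
  induction n generalizing H A F N m p with
  | zero => omega
  | succ n ih =>
    induction hk : H.edgeSet.ncard using Nat.strong_induction_on generalizing H A F N m p with
    | _ k ihk =>
    subst hk
    by_cases hA : ∀ a ∈ A, ∀ b ∈ A, ¬ H.Adj a b
    · rw [h.graphGamma_eq_of_forall_not_adj hA]
      exact CoeffLE.refl _
    push Not at hA
    obtain ⟨u, hu, v, hv, huv⟩ := hA
    have hlt := ncard_edgeSet_deleteEdge_lt huv
    have huN : u ∉ N := fun hN => Finset.disjoint_left.1 h.disj hu (h.sub hN)
    have hvN : v ∉ N := fun hN => Finset.disjoint_left.1 h.disj hv (h.sub hN)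
    rw [graphGamma_deleteEdge (H.attach N (p m)) u v, graphGamma_deleteEdge (H.attach N (p 0)) u v,
      attach_deleteEdge huN hvN, attach_deleteEdge huN hvN]
    refine (ihk _ hlt (h.deleteEdge hu hv) hn rfl).add ((CoeffLE.refl X).mul
      (CoeffLE.sum (h.innerBridgedSets_subset hu hv) fun I hI => ?_))
    have hIb := (mem_innerBridgedSets.1 hI).1
    obtain ⟨hIU, hIc, hIn⟩ := mem_bridgedSets.1 hIb
    have huI := (mem_of_mem_bridgedSets hIb).1
    have hlast : ∀ x ∈ I, x ∈ F → p m ∈ I := fun x => h.last_mem hu huI hIU hIc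
    have hle : ∀ i ≤ m, ∀ j ≤ i, p i ∈ I → p j ∈ I :=
      fun i hi j hj hpi => h.mem_of_le hu huI hIU hIc hi hj hpi
    have hcard : ((A ∪ pathSet p m ∪ F) \ I).card < n :=
      lt_of_lt_of_le (Finset.card_lt_card (Finset.sdiff_ssubset hIU ⟨u, huI⟩))
        (Nat.lt_succ_iff.1 hn)
    have hdF : p m ∉ I → Disjoint F I := fun hm => Finset.disjoint_left.2 fun x hx hxI =>
      hm (hlast x hxI hx)
    refine CoeffLE.mul ?_ ?_
    -- The factor on `I`: with `p m` the whole path lies in `I`, and the restricted configuration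
    -- has fewer edges; without `p m` the set misses `F`, so both graphs agree on it.
    · by_cases hm : p m ∈ I
      · have h' := (h.deleteEdge hu hv).restrict (I := I) (hle m le_rfl 0 (Nat.zero_le m) hm)
        have hP : pathSet p m ⊆ I := fun x hx => by
          obtain ⟨i, hi, rfl⟩ := mem_pathSet.1 hx
          exact hle m le_rfl i hi hm
        have hIe : A ∩ I ∪ pathSet p m ∪ F ∩ I = I := by
          have := Finset.inter_eq_right.2 hIU
          rwa [Finset.union_inter_distrib_right, Finset.union_inter_distrib_right,
            Finset.inter_eq_left.2 hP] at this
        have := ihk _ hlt h' (by rw [hIe]; exact lt_of_le_of_lt (Finset.card_le_card hIU) hn) rfl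
        rw [hIe] at this
        have hcongr : ∀ q, graphGamma ((H.deleteEdges {s(u, v)}).attach N q) I =
            graphGamma ((H.deleteEdges {s(u, v)}).attach (N ∩ I) q) I := by
          refine fun q => graphGamma_congr fun a ha b hb => ?_
          simp only [attach_adj, Finset.mem_inter, ha, hb, and_true]
        rwa [hcongr, hcongr]
      · have hN : Disjoint N I := Finset.disjoint_of_subset_left h.sub (hdF hm)
        rw [graphGamma_congr (G' := (H.deleteEdges {s(u, v)}).attach N (p 0)) fun a ha b hb => by
          rw [attach_adj_of_disjoint hN ha hb, attach_adj_of_disjoint hN ha hb]]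
        exact CoeffLE.refl _
    · by_cases hm : p m ∈ I
      -- Both attachment points are swallowed, and the vertices of `N` outside `I` are neighbours of
      -- `I` in either graph; the two contractions coincide.
      · have hall : ∀ i ≤ m, p i ∈ I := fun i hi => hle m le_rfl i hi hm
        have key : ∀ q q', q ∈ I → q' ∈ I → q' ∉ F → ∀ a ∉ I,
            (∃ i ∈ I, (H.attach N q).Adj i a) → ∃ i ∈ I, (H.attach N q').Adj i a := by
          rintro q q' hq hq' hqF a ha ⟨i, hi, -, hia | ⟨rfl, haN⟩ | ⟨rfl, hiN⟩⟩
          · exact ⟨i, hi, le_attach _ _ _ hia⟩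
          · exact ⟨q', hq', fun e => hqF (e ▸ h.sub haN), Or.inr (Or.inl ⟨rfl, haN⟩)⟩
          · exact (ha hq).elim
        have key' : ∀ q ∈ I, ∀ a ∉ I, ∀ b ∉ I, ((H.attach N q).Adj a b ↔ H.Adj a b) := by
          intro q hq a ha b hb
          constructor
          · rintro ⟨-, hab | ⟨rfl, -⟩ | ⟨rfl, -⟩⟩
            · exact hab
            · exact (ha hq).elim
            · exact (hb hq).elim
          · exact fun hab => le_attach _ _ _ hab
        have hm0 := hall 0 (Nat.zero_le m)
        have h0F := h.notMem_right 0 (Nat.zero_le m)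
        have hmF := h.notMem_right m le_rfl
        rw [graphGamma_congr (G' := (H.attach N (p 0)).contract I) fun a ha b hb => ?_]
        · exact CoeffLE.refl _
        · have ha := (Finset.mem_sdiff.1 ha).2
          have hb := (Finset.mem_sdiff.1 hb).2
          rw [contract_adj, contract_adj, key' _ hm a ha b hb, key' _ hm0 a ha b hb,
            show (∃ i ∈ I, (H.attach N (p m)).Adj i a) ↔ ∃ i ∈ I, (H.attach N (p 0)).Adj i a from
              ⟨key _ _ hm hm0 h0F a ha, key _ _ hm0 hm hmF a ha⟩,
            show (∃ i ∈ I, (H.attach N (p m)).Adj i b) ↔ ∃ i ∈ I, (H.attach N (p 0)).Adj i b from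
              ⟨key _ _ hm hm0 h0F b hb, key _ _ hm0 hm hmF b hb⟩]
      · have hFI := hdF hm
        have hN : Disjoint N I := Finset.disjoint_of_subset_left h.sub hFI
        have hFd := Finset.disjoint_left.1 hFI
        by_cases h0 : p 0 ∈ I
        · have hIAP : I ⊆ A ∪ pathSet p m := fun x hx =>
            (Finset.mem_union.1 (hIU hx)).resolve_right fun hF => hFd hF hx
          have hex : ∃ s, p s ∉ I := ⟨m, hm⟩
          classical
          -- The first path vertex outside `I`; it becomes the root after contraction.
          obtain ⟨s, hs, hmin⟩ : ∃ s, p s ∉ I ∧ ∀ t < s, p t ∈ I :=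
            ⟨Nat.find hex, Nat.find_spec hex, fun t ht => not_not.1 (Nat.find_min hex ht)⟩
          have hs1 : 1 ≤ s := Nat.one_le_iff_ne_zero.2 fun e => hs (e ▸ h0)
          have hsm : s ≤ m := by
            by_contra hc
            exact hm (hmin m (by omega))
          have hiff : ∀ i ≤ m, (p i ∈ I ↔ i < s) := fun i hi =>
            ⟨fun hpi => by_contra fun hc => hs (hle i hi s (by omega) hpi), hmin i⟩
          have h' := h.contract_of_segment hIAP hs1 hsm hiff
          have hUe : insert (p s) (A \ I) ∪ pathSet (fun i => p (s + i)) (m - s) ∪ F =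
              (A ∪ pathSet p m ∪ F) \ I := by
            ext x
            simp only [Finset.mem_union, Finset.mem_insert, Finset.mem_sdiff, mem_pathSet]
            constructor
            · rintro (((rfl | hx) | ⟨i, hi, rfl⟩) | hx)
              · exact ⟨Or.inl (Or.inr ⟨s, hsm, rfl⟩), hs⟩
              · exact ⟨Or.inl (Or.inl hx.1), hx.2⟩
              · refine ⟨Or.inl (Or.inr ⟨s + i, by omega, rfl⟩), ?_⟩
                rw [hiff (s + i) (by omega)]
                omega
              · exact ⟨Or.inr hx, hFd hx⟩
            · rintro ⟨((hx | ⟨i, hi, rfl⟩) | hx), hxI⟩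
              · exact Or.inl (Or.inl (Or.inr ⟨hx, hxI⟩))
              · rw [hiff i hi] at hxI
                exact Or.inl (Or.inr ⟨i - s, by omega, by rw [Nat.add_sub_cancel' (by omega)]⟩)
              · exact Or.inr hx
          have := ih h' (by rw [hUe]; exact hcard)
          simp only [hUe, Nat.add_sub_cancel' hsm, Nat.add_zero] at this
          rw [attach_contract hm hN]
          -- In the original graph both `p s` and `N` are adjacent to `I`, through `p (s - 1)` and
          -- `p 0`, so contraction joins `p s` to `N`. It may create further edges, hence only a
          -- comparison.
          refine this.trans (graphGamma_mono fun a ha b hb hab => ?_)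
          have hps : ∃ i ∈ I, (H.attach N (p 0)).Adj i (p s) := by
            refine ⟨p (s - 1), hmin _ (by omega), le_attach _ _ _ ?_⟩
            have := h.adj (s - 1) (by omega)
            rwa [Nat.sub_add_cancel hs1] at this
          have hNb : ∀ b ∈ N, ∃ i ∈ I, (H.attach N (p 0)).Adj i b := fun b hb =>
            ⟨p 0, h0, fun e => h.notMem_right 0 (Nat.zero_le m) (e ▸ h.sub hb),
              Or.inr (Or.inl ⟨rfl, hb⟩)⟩
          obtain ⟨hne, ⟨-, hab | ⟨⟨i, hi, hia⟩, j, hj, hjb⟩⟩ | ⟨rfl, hbN⟩ | ⟨rfl, haN⟩⟩ := hab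
          · exact ⟨hne, Or.inl (le_attach _ _ _ hab)⟩
          · exact ⟨hne, Or.inr ⟨⟨i, hi, le_attach _ _ _ hia⟩, j, hj, le_attach _ _ _ hjb⟩⟩
          · exact ⟨hne, Or.inr ⟨hps, hNb b hbN⟩⟩
          · exact ⟨hne, Or.inr ⟨hNb a haN, hps⟩⟩
        · have hnp : ∀ i ≤ m, p i ∉ I := fun i hi hpi => h0 (hle i hi 0 (Nat.zero_le i) hpi)
          have hIA : I ⊆ A := by
            intro x hx
            rcases Finset.mem_union.1 (hIU hx) with hx' | hx'
            · refine (Finset.mem_union.1 hx').resolve_right fun hxp => ?_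
              obtain ⟨i, hi, rfl⟩ := mem_pathSet.1 hxp
              exact hnp i hi hx
            · exact (hFd hx' hx).elim
          have hP : Disjoint (pathSet p m) I := Finset.disjoint_left.2 fun x hx => by
            obtain ⟨i, hi, rfl⟩ := mem_pathSet.1 hx
            exact hnp i hi
          have hUe : (A \ I) ∪ pathSet p m ∪ F = (A ∪ pathSet p m ∪ F) \ I := by
            rw [Finset.union_sdiff_distrib, Finset.union_sdiff_distrib,
              Finset.sdiff_eq_self_of_disjoint hP, Finset.sdiff_eq_self_of_disjoint hFI]
          have := ih (h.contract_of_root_notMem hIA h0) (by rw [hUe]; exact hcard)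
          rw [hUe] at this
          rwa [attach_contract hm hN, attach_contract h0 hN]

end ShiftConfig

end Shift

end SimpleGraph

/-! ### Linear functionals on coordinate simplices -/

section CoordSimplex

variable {V : Type*} [Fintype V] [DecidableEq V]

theorem mem_coordSimplex {I : Finset V} {x : V → ℝ} :
    x ∈ coordSimplex I ↔ (∀ i, 0 ≤ x i) ∧ (∀ i ∉ I, x i = 0) ∧ ∑ i, x i = 1 := by
  constructor
  · have hconv : Convex ℝ {x : V → ℝ | (∀ i, 0 ≤ x i) ∧ (∀ i ∉ I, x i = 0) ∧ ∑ i, x i = 1} := by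
      rintro x ⟨hx1, hx2, hx3⟩ y ⟨hy1, hy2, hy3⟩ a b ha hb hab
      refine ⟨fun i => ?_, fun i hi => ?_, ?_⟩
      · simp only [Pi.add_apply, Pi.smul_apply, smul_eq_mul]
        exact add_nonneg (mul_nonneg ha (hx1 i)) (mul_nonneg hb (hy1 i))
      · simp [hx2 i hi, hy2 i hi]
      · simp only [Pi.add_apply, Pi.smul_apply, smul_eq_mul, Finset.sum_add_distrib,
          ← Finset.mul_sum, hx3, hy3, mul_one, hab]
    refine fun hx => convexHull_min ?_ hconv hx
    rintro _ ⟨i, hi, rfl⟩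
    refine ⟨fun j => ?_, fun j hj => ?_, ?_⟩
    · simp only [Pi.single_apply]
      split_ifs <;> simp
    · have : j ≠ i := fun e => hj (e ▸ hi)
      simp [this]
    · simp
  · rintro ⟨h1, h2, h3⟩
    have hx : x = ∑ i ∈ I, x i • (Pi.single i 1 : V → ℝ) := by
      ext j
      simp only [Finset.sum_apply, Pi.smul_apply, Pi.single_apply, smul_eq_mul, mul_ite, mul_one,
        mul_zero, Finset.sum_ite_eq]
      split_ifs with hj
      · rfl
      · exact h2 j hj
    rw [hx]
    refine (convex_convexHull ℝ _).sum_mem (fun i _ => h1 i) ?_ fun i hi =>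
      subset_convexHull ℝ _ ⟨i, hi, rfl⟩
    rw [← h3]
    exact Finset.sum_subset (Finset.subset_univ I) fun i _ hi => h2 i hi

theorem single_mem_coordSimplex {I : Finset V} {i : V} (hi : i ∈ I) :
    (Pi.single i 1 : V → ℝ) ∈ coordSimplex I := subset_convexHull ℝ _ ⟨i, hi, rfl⟩

theorem coordSimplex_mono {I J : Finset V} (h : I ⊆ J) : coordSimplex I ⊆ coordSimplex J :=
  convexHull_mono (Set.image_mono h)

/-- The linear functional with coefficients `w`. -/
def weightForm (w : V → ℝ) : (V → ℝ) →ₗ[ℝ] ℝ := ∑ i, w i • LinearMap.proj i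

theorem weightForm_apply (w x : V → ℝ) : weightForm w x = ∑ i, w i * x i := by
  simp [weightForm]

theorem weightForm_single (w : V → ℝ) (i : V) : weightForm w (Pi.single i 1) = w i := by
  simp [weightForm_apply, Pi.single_apply]

theorem weightForm_le {w x : V → ℝ} {I : Finset V} (hx : x ∈ coordSimplex I) {r : V}
    (hr : r ∈ SimpleGraph.argmaxOn w I) : weightForm w x ≤ w r := by
  obtain ⟨h1, h2, h3⟩ := mem_coordSimplex.1 hx
  rw [weightForm_apply, ← mul_one (w r), ← h3, Finset.mul_sum]
  refine Finset.sum_le_sum fun i _ => ?_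
  by_cases hi : i ∈ I
  · exact mul_le_mul_of_nonneg_right ((SimpleGraph.mem_argmaxOn.1 hr).2 i hi) (h1 i)
  · simp [h2 i hi]

/-- The value is a weighted average of the `w i`, so it attains the maximum exactly when no mass
lies off the maximizers. -/
theorem weightForm_eq_iff {w x : V → ℝ} {I : Finset V} (hx : x ∈ coordSimplex I) {r : V}
    (hr : r ∈ SimpleGraph.argmaxOn w I) :
    weightForm w x = w r ↔ x ∈ coordSimplex (SimpleGraph.argmaxOn w I) := by
  obtain ⟨h1, h2, h3⟩ := mem_coordSimplex.1 hx
  have hle : ∀ i ∈ Finset.univ, w i * x i ≤ w r * x i := by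
    intro i _
    by_cases hi : i ∈ I
    · exact mul_le_mul_of_nonneg_right ((SimpleGraph.mem_argmaxOn.1 hr).2 i hi) (h1 i)
    · simp [h2 i hi]
  have hr' : w r = ∑ i, w r * x i := by rw [← Finset.mul_sum, h3, mul_one]
  rw [weightForm_apply, hr', Finset.sum_eq_sum_iff_of_le hle, mem_coordSimplex]
  constructor
  · refine fun h => ⟨h1, fun i hi => ?_, h3⟩
    by_contra hne
    have hiI : i ∈ I := by_contra fun hiI => hne (h2 i hiI)
    have hwi := mul_right_cancel₀ hne (h i (Finset.mem_univ i))
    exact hi (SimpleGraph.mem_argmaxOn.2 ⟨hiI, fun j hj =>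
      hwi ▸ (SimpleGraph.mem_argmaxOn.1 hr).2 j hj⟩)
  · rintro ⟨-, h, -⟩ i -
    by_cases hi : i ∈ SimpleGraph.argmaxOn w I
    · rw [le_antisymm ((SimpleGraph.mem_argmaxOn.1 hr).2 i (SimpleGraph.mem_argmaxOn.1 hi).1)
        ((SimpleGraph.mem_argmaxOn.1 hi).2 r (SimpleGraph.mem_argmaxOn.1 hr).1)]
    · rw [h i hi, mul_zero, mul_zero]

theorem sub_single_mem_dirSpan {σ : Finset V → Finset V} {I : Finset V} {x : V → ℝ}
    (hx : x ∈ coordSimplex (σ I)) {k : V} (hk : k ∈ σ I) :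
    x - Pi.single k 1 ∈ SimpleGraph.dirSpan σ := by
  obtain ⟨h1, h2, h3⟩ := mem_coordSimplex.1 hx
  have : x - Pi.single k 1 = ∑ i, x i • (Pi.single i 1 - Pi.single k 1 : V → ℝ) := by
    simp only [smul_sub, Finset.sum_sub_distrib, ← Finset.sum_smul, h3, one_smul]
    congr 1
    ext j
    simp [Finset.sum_apply, Pi.single_apply]
  rw [this]
  refine Submodule.sum_mem _ fun i _ => ?_
  by_cases hi : i ∈ σ I
  · exact Submodule.smul_mem _ _ (SimpleGraph.sub_mem_dirSpan hi hk)
  · simp [h2 i hi]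

end CoordSimplex

namespace SimpleGraph

/-! ### Faces of the graph-associahedron as maximizer systems -/

section Faces

variable {V : Type*} [Fintype V] [DecidableEq V]

/-- If no proper cut is closed, the set reachable from a vertex is everything; conversely a walk
from inside a cut to outside crosses its boundary. -/
theorem connOn_iff {G : SimpleGraph V} {I : Finset V} :
    G.ConnOn I ↔ (G.induce (I : Set V)).Connected := by
  classical
  rw [connected_iff]
  constructor
  · rintro ⟨⟨v, hv⟩, h⟩
    refine ⟨?_, ⟨⟨v, hv⟩⟩⟩
    have key : ∀ x y : (I : Set V), (G.induce (I : Set V)).Reachable x y := by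
      intro x y
      have hA : I.filter (fun z => ∃ hz : z ∈ I, (G.induce (I : Set V)).Reachable x ⟨z, hz⟩) = I := by
        by_contra hne
        obtain ⟨a, ha, b, hb, hba, hab⟩ := h _ (Finset.filter_subset _ I)
          ⟨x, Finset.mem_filter.2 ⟨x.2, x.2, Reachable.refl _⟩⟩ hne
        obtain ⟨haI, _, hra⟩ := Finset.mem_filter.1 ha
        refine hba (Finset.mem_filter.2 ⟨hb, hb, hra.trans (Adj.reachable ?_)⟩)
        exact hab
      have hy := hA.superset y.2
      exact (Finset.mem_filter.1 hy).2.2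
    exact key
  · rintro ⟨hp, ⟨v⟩⟩
    refine ⟨⟨v, v.2⟩, fun A hA hA0 hAI => ?_⟩
    obtain ⟨a, ha⟩ := hA0
    obtain ⟨b, hb, hbA⟩ := Finset.exists_of_ssubset (Finset.ssubset_iff_subset_ne.2 ⟨hA, hAI⟩)
    obtain ⟨p⟩ := hp ⟨a, hA ha⟩ ⟨b, hb⟩
    obtain ⟨d, -, hd1, hd2⟩ := p.exists_boundary_dart {z | (z : V) ∈ A} ha hbA
    exact ⟨d.fst, hd1, d.snd, d.snd.2, hd2, d.adj⟩

theorem mem_buildingSet {G : SimpleGraph V} {I : Finset V} :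
    I ∈ G.buildingSet.sets ↔ G.ConnOn I := by
  rw [connOn_iff]
  simp [buildingSet]

/-- The face of the graph-associahedron that corresponds to a system. -/
noncomputable def faceOf (G : SimpleGraph V) (σ : Finset V → Finset V) : Set (V → ℝ) :=
  ∑ I ∈ G.buildingSet.sets, coordSimplex (σ I)

theorem mem_faceOf {G : SimpleGraph V} {σ : Finset V → Finset V} {x : V → ℝ} :
    x ∈ faceOf G σ ↔ ∃ g : Finset V → V → ℝ, (∀ I ∈ G.buildingSet.sets, g I ∈ coordSimplex (σ I)) ∧
      ∑ I ∈ G.buildingSet.sets, g I = x := by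
  rw [faceOf, Set.mem_finsetSum]
  simp only [exists_prop]

theorem mem_graphAssociahedron {G : SimpleGraph V} {x : V → ℝ} :
    x ∈ G.graphAssociahedron ↔ ∃ g : Finset V → V → ℝ,
      (∀ I ∈ G.buildingSet.sets, g I ∈ coordSimplex I) ∧
        ∑ I ∈ G.buildingSet.sets, g I = x := mem_faceOf (σ := id)

theorem faceSystem_univ {G : SimpleGraph V} {I : Finset V} (hI : I ∈ G.buildingSet.sets)
    (w : V → ℝ) : faceSystem G Finset.univ w I = argmaxOn w I := by
  simp [faceSystem, mem_buildingSet.1 hI]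

variable [Nonempty V]

theorem exists_selection (G : SimpleGraph V) (w : V → ℝ) :
    ∃ r : Finset V → V, ∀ I ∈ G.buildingSet.sets, r I ∈ argmaxOn w I := by
  have : ∀ I ∈ G.buildingSet.sets, ∃ r, r ∈ argmaxOn w I := fun I hI =>
    argmaxOn_nonempty w (G.buildingSet.nonempty_of_mem I hI)
  choose! r hr using this
  exact ⟨r, hr⟩

/-- A sum is maximal exactly when each summand is: every summand is bounded by its own maximum, and
equality of the sums forces equality termwise. -/
theorem faceOf_faceSystem (G : SimpleGraph V) (w : V → ℝ) :
    faceOf G (faceSystem G Finset.univ w) = {x ∈ G.graphAssociahedron |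
      ∀ y ∈ G.graphAssociahedron, weightForm w y ≤ weightForm w x} := by
  obtain ⟨r, hr⟩ := exists_selection G w
  ext x
  rw [Set.mem_ofPred_eq, mem_faceOf]
  constructor
  · rintro ⟨g, hg, rfl⟩
    have hg' : ∀ I ∈ G.buildingSet.sets, g I ∈ coordSimplex (argmaxOn w I) := fun I hI => by
      rw [← faceSystem_univ hI]
      exact hg I hI
    have hgI := fun I hI => coordSimplex_mono (argmaxOn_subset w I) (hg' I hI)
    refine ⟨mem_graphAssociahedron.2 ⟨g, hgI, rfl⟩, fun y hy => ?_⟩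
    obtain ⟨k, hk, rfl⟩ := mem_graphAssociahedron.1 hy
    rw [map_sum, map_sum]
    refine Finset.sum_le_sum fun I hI => ?_
    rw [(weightForm_eq_iff (hgI I hI) (hr I hI)).2 (hg' I hI)]
    exact weightForm_le (hk I hI) (hr I hI)
  · rintro ⟨hx, hmax⟩
    obtain ⟨g, hg, rfl⟩ := mem_graphAssociahedron.1 hx
    refine ⟨g, fun I hI => ?_, rfl⟩
    have h1 := hmax _ (mem_graphAssociahedron.2 ⟨fun I => Pi.single (r I) 1, fun I hI =>
      single_mem_coordSimplex (argmaxOn_subset w I (hr I hI)), rfl⟩)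
    rw [map_sum, map_sum] at h1
    simp only [weightForm_single] at h1
    have hle : ∀ I ∈ G.buildingSet.sets, weightForm w (g I) ≤ w (r I) :=
      fun I hI => weightForm_le (hg I hI) (hr I hI)
    have := (Finset.sum_eq_sum_iff_of_le hle).1 (le_antisymm (Finset.sum_le_sum hle) h1) I hI
    rw [faceSystem_univ hI]
    exact (weightForm_eq_iff (hg I hI) (hr I hI)).1 this

theorem faceOf_nonempty (G : SimpleGraph V) (w : V → ℝ) :
    (faceOf G (faceSystem G Finset.univ w)).Nonempty := by
  obtain ⟨r, hr⟩ := exists_selection G w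
  refine ⟨_, mem_faceOf.2 ⟨fun I => Pi.single (r I) 1, fun I hI => ?_, rfl⟩⟩
  rw [faceSystem_univ hI]
  exact single_mem_coordSimplex (hr I hI)

theorem isExposed_and_nonempty_iff {G : SimpleGraph V} {F : Set (V → ℝ)} :
    IsExposed ℝ G.graphAssociahedron F ∧ F.Nonempty ↔
      ∃ σ ∈ faceSystems G Finset.univ, faceOf G σ = F := by
  constructor
  · rintro ⟨hF, hF0⟩
    obtain ⟨l, rfl⟩ := hF hF0
    refine ⟨_, mem_faceSystems.2 ⟨fun i => l (Pi.single i 1), rfl⟩, ?_⟩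
    have hl : ∀ x, weightForm (fun i => l (Pi.single i 1)) x = l x := by
      intro x
      rw [weightForm_apply]
      have := LinearMap.pi_apply_eq_sum_univ (l : (V → ℝ) →ₗ[ℝ] ℝ) x
      simp only [ContinuousLinearMap.coe_coe, smul_eq_mul] at this
      rw [this]
      refine Finset.sum_congr rfl fun i _ => ?_
      rw [mul_comm]
      congr 2
      ext j
      simp [Pi.single_apply, eq_comm]
    rw [faceOf_faceSystem]
    simp only [hl]
  · rintro ⟨σ, hσ, rfl⟩
    obtain ⟨w, rfl⟩ := mem_faceSystems.1 hσ
    refine ⟨fun _ => ⟨LinearMap.toContinuousLinearMap (weightForm w), ?_⟩, faceOf_nonempty G w⟩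
    rw [faceOf_faceSystem]
    rfl

/-- Choose the vertex `e_i` in the summand `I` and any maximizing vertices elsewhere. The resulting
point maximizes `w'`, hence so does each summand, in particular `e_i` on `I`. It follows that a face
determines its system. -/
theorem argmaxOn_subset_of_faceOf_subset {G : SimpleGraph V} {w w' : V → ℝ}
    (h : faceOf G (faceSystem G Finset.univ w) ⊆ faceOf G (faceSystem G Finset.univ w'))
    {I : Finset V} (hI : I ∈ G.buildingSet.sets) : argmaxOn w I ⊆ argmaxOn w' I := by
  intro i hi
  obtain ⟨r₀, hr₀⟩ := exists_selection G w
  obtain ⟨r', hr'⟩ := exists_selection G w'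
  have hr : ∀ J ∈ G.buildingSet.sets, Function.update r₀ I i J ∈ argmaxOn w J := by
    intro J hJ
    by_cases hJI : J = I
    · subst hJI
      simpa using hi
    · rw [Function.update_of_ne hJI]
      exact hr₀ J hJ
  have hx : ∑ J ∈ G.buildingSet.sets, (Pi.single (Function.update r₀ I i J) 1 : V → ℝ) ∈
      faceOf G (faceSystem G Finset.univ w) := mem_faceOf.2 ⟨_, fun J hJ => by
    rw [faceSystem_univ hJ]
    exact single_mem_coordSimplex (hr J hJ), rfl⟩
  have hx' := h hx
  rw [faceOf_faceSystem] at hx'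
  have h1 := hx'.2 _ (mem_graphAssociahedron.2 ⟨fun J => Pi.single (r' J) 1, fun J hJ =>
    single_mem_coordSimplex (argmaxOn_subset w' J (hr' J hJ)), rfl⟩)
  rw [map_sum, map_sum] at h1
  simp only [weightForm_single] at h1
  have hle : ∀ J ∈ G.buildingSet.sets, w' (Function.update r₀ I i J) ≤ w' (r' J) :=
    fun J hJ => (mem_argmaxOn.1 (hr' J hJ)).2 _ (argmaxOn_subset w J (hr J hJ))
  have := (Finset.sum_eq_sum_iff_of_le hle).1 (le_antisymm (Finset.sum_le_sum hle) h1) I hI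
  rw [Function.update_self] at this
  exact mem_argmaxOn.2 ⟨argmaxOn_subset w I hi, fun j hj =>
    this ▸ (mem_argmaxOn.1 (hr' I hI)).2 j hj⟩

theorem faceOf_injOn (G : SimpleGraph V) :
    Set.InjOn (faceOf G) (faceSystems G Finset.univ : Set (Finset V → Finset V)) := by
  intro σ hσ τ hτ h
  obtain ⟨w, rfl⟩ := mem_faceSystems.1 hσ
  obtain ⟨w', rfl⟩ := mem_faceSystems.1 hτ
  funext I
  by_cases hI : I ∈ G.buildingSet.sets
  · rw [faceSystem_univ hI, faceSystem_univ hI]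
    exact (argmaxOn_subset_of_faceOf_subset h.subset hI).antisymm
      (argmaxOn_subset_of_faceOf_subset h.superset hI)
  · rw [mem_buildingSet] at hI
    simp [faceSystem, hI]

/-- Two points of the face that differ only in the summand `I`, with `e_i` against `e_j`, have
difference `e_i - e_j`; conversely every difference of points splits into such directions. -/
theorem polytopeDim_faceOf (G : SimpleGraph V) (w : V → ℝ) :
    polytopeDim (faceOf G (faceSystem G Finset.univ w)) =
      sysDim (faceSystem G Finset.univ w) := by
  rw [polytopeDim, sysDim]
  suffices vectorSpan ℝ (faceOf G (faceSystem G Finset.univ w)) =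
      dirSpan (faceSystem G Finset.univ w) by rw [this]
  obtain ⟨r, hr⟩ := exists_selection G w
  have hr' : ∀ I ∈ G.buildingSet.sets, r I ∈ faceSystem G Finset.univ w I := fun I hI => by
    rw [faceSystem_univ hI]
    exact hr I hI
  refine le_antisymm ?_ (dirSpan_le fun I i hi j hj => ?_)
  · rw [vectorSpan_def, Submodule.span_le]
    rintro _ ⟨x, hx, y, hy, rfl⟩
    obtain ⟨g, hg, rfl⟩ := mem_faceOf.1 hx
    obtain ⟨k, hk, rfl⟩ := mem_faceOf.1 hy
    change _ - _ ∈ dirSpan _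
    rw [← Finset.sum_sub_distrib]
    refine Submodule.sum_mem _ fun I hI => ?_
    have := Submodule.sub_mem _ (sub_single_mem_dirSpan (hg I hI) (hr' I hI))
      (sub_single_mem_dirSpan (hk I hI) (hr' I hI))
    rwa [sub_sub_sub_cancel_right] at this
  · have hI : I ∈ G.buildingSet.sets := by
      rw [mem_buildingSet]
      by_contra hI
      simp [faceSystem, hI] at hi
    have hmem : ∀ i ∈ faceSystem G Finset.univ w I,
        ∑ J ∈ G.buildingSet.sets,
          Function.update (fun J => (Pi.single (r J) 1 : V → ℝ)) I (Pi.single i 1) J ∈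
            faceOf G (faceSystem G Finset.univ w) := by
      refine fun i hi => mem_faceOf.2 ⟨_, fun J hJ => ?_, rfl⟩
      by_cases hJI : J = I
      · subst hJI
        rw [Function.update_self]
        exact single_mem_coordSimplex hi
      · rw [Function.update_of_ne hJI]
        exact single_mem_coordSimplex (hr' J hJ)
    have := vsub_mem_vectorSpan ℝ (hmem i hi) (hmem j hj)
    rwa [Finset.sum_update_of_mem hI, Finset.sum_update_of_mem hI, vsub_eq_sub,
      add_sub_add_right_eq_sub] at this

theorem graphAssociahedron_eq_faceOf (G : SimpleGraph V) :
    G.graphAssociahedron = faceOf G (faceSystem G Finset.univ 0) := by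
  rw [faceOf_faceSystem]
  ext x
  simp [weightForm_apply]

theorem polytopeDim_graphAssociahedron (G : SimpleGraph V) :
    polytopeDim G.graphAssociahedron = assocDim G Finset.univ := by
  rw [graphAssociahedron_eq_faceOf, polytopeDim_faceOf, assocDim]

theorem sysDim_le_assocDim {G : SimpleGraph V} {U : Finset V} (w : V → ℝ) :
    sysDim (faceSystem G U w) ≤ assocDim G U := by
  refine Submodule.finrank_mono (dirSpan_le fun I i hi j hj => ?_)
  have hsub : faceSystem G U w I ⊆ faceSystem G U 0 I := by
    unfold faceSystem
    split_ifs with h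
    · exact fun i hi => mem_argmaxOn.2 ⟨argmaxOn_subset w I hi, fun _ _ => le_rfl⟩
    · exact subset_rfl
  exact sub_mem_dirSpan (hsub hi) (hsub hj)

theorem faceCount_graphAssociahedron (G : SimpleGraph V) (i : ℕ) :
    faceCount G.graphAssociahedron i =
      ((faceSystems G Finset.univ).filter (sysDim · = i)).card := by
  rw [← Set.ncard_coe_finset, faceCount,
    ← ((faceOf_injOn G).mono (Finset.coe_subset.2 (Finset.filter_subset _ _))).ncard_image]
  congr 1
  ext F
  rw [Set.mem_ofPred_eq, ← and_assoc, isExposed_and_nonempty_iff]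
  simp only [Finset.coe_filter, Set.mem_image, Set.mem_ofPred_eq]
  constructor
  · rintro ⟨⟨σ, hσ, rfl⟩, h⟩
    obtain ⟨w, rfl⟩ := mem_faceSystems.1 hσ
    exact ⟨_, ⟨hσ, by rw [← h, polytopeDim_faceOf]⟩, rfl⟩
  · rintro ⟨σ, ⟨hσ, h⟩, rfl⟩
    obtain ⟨w, rfl⟩ := mem_faceSystems.1 hσ
    exact ⟨⟨_, hσ, rfl⟩, by rw [← h, polytopeDim_faceOf]⟩

theorem fPolynomial_graphAssociahedron (G : SimpleGraph V) :
    fPolynomial G.graphAssociahedron =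
      ∑ σ ∈ faceSystems G Finset.univ, (X : ℤ[X]) ^ sysDim σ := by
  rw [fPolynomial, polytopeDim_graphAssociahedron,
    ← Finset.sum_fiberwise_of_maps_to (g := sysDim) (t := Finset.range (assocDim G Finset.univ + 1))]
  · refine Finset.sum_congr rfl fun i _ => ?_
    rw [faceCount_graphAssociahedron, Finset.sum_congr rfl fun σ hσ => by
      rw [(Finset.mem_filter.1 hσ).2], Finset.sum_const]
    simp
  · intro σ hσ
    obtain ⟨w, rfl⟩ := mem_faceSystems.1 hσ
    exact Finset.mem_range.2 (Nat.lt_succ_of_le (sysDim_le_assocDim w))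

theorem isGammaPolynomial_graphAssociahedron (G : SimpleGraph V) :
    IsGammaPolynomial G.graphAssociahedron
      ((graphGamma G Finset.univ).map (Nat.castRingHom ℤ)) := by
  obtain ⟨hdeg, hval⟩ := graphGamma_spec G Finset.univ
  rw [IsGammaPolynomial, polytopeDim_graphAssociahedron]
  set d := assocDim G Finset.univ
  set g := graphGamma G Finset.univ
  refine ⟨(natDegree_map_le).trans (by omega), ?_⟩
  apply Polynomial.map_injective (Int.castRingHom ℝ) Int.cast_injective
  -- Both sides are polynomials, so the values at real `x > 1` supplied by `GammaAt` suffice.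
  refine Polynomial.eq_of_infinite_eval_eq _ _ ((Set.Ioi_infinite (1 : ℝ)).mono fun x hx => ?_)
  have hx : 1 < x := hx
  have hx0 : 1 + x ≠ 0 := by positivity
  have h1 : ((hPolynomial G.graphAssociahedron).map (Int.castRingHom ℝ)).eval x =
      hVal G Finset.univ x := by
    rw [hPolynomial, fPolynomial_graphAssociahedron, hVal]
    simp [Polynomial.map_sum, eval_finsetSum]
  rw [Set.mem_ofPred_eq, h1, hval x hx, aeval_eq_sum_range' (n := d / 2 + 1) (by omega)]
  simp only [Polynomial.map_sum, eval_finsetSum, Polynomial.map_mul, eval_mul, map_C, eval_C,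
    Polynomial.map_pow, eval_pow, map_X, eval_X, Polynomial.map_add, eval_add, Polynomial.map_one,
    eval_one, coeff_map, Finset.mul_sum]
  refine Finset.sum_congr rfl fun i hi => ?_
  have hi' : 2 * i ≤ d := by have := Finset.mem_range.1 hi; omega
  obtain ⟨k, hk⟩ := Nat.exists_eq_add_of_le hi'
  rw [hk, Nat.add_sub_cancel_left, pow_add, div_pow, ← pow_mul]
  simp only [nsmul_eq_mul, map_natCast, eq_natCast]
  field_simp

theorem gammaPolynomial_graphAssociahedron (G : SimpleGraph V) :
    gammaPolynomial G.graphAssociahedron =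
      (graphGamma G Finset.univ).map (Nat.castRingHom ℤ) := by
  have h : ∃ g, IsGammaPolynomial G.graphAssociahedron g :=
    ⟨_, isGammaPolynomial_graphAssociahedron G⟩
  rw [gammaPolynomial, dif_pos h]
  exact h.choose_spec.unique (isGammaPolynomial_graphAssociahedron G)

end Faces

/-! ### Tree shifts as shift configurations -/

section TreeShift

variable {V : Type*} [Fintype V]

theorem Walk.IsPath.getVert_inj {G : SimpleGraph V} {a b : V} {p : G.Walk a b} (hp : p.IsPath)
    {i j : ℕ} (hi : i ≤ p.length) (hj : j ≤ p.length) (h : p.getVert i = p.getVert j) : i = j :=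
  hp.getVert_injOn hi hj h

/-- A vertex of degree at most two on a path has no neighbours outside of the path. -/
theorem Walk.IsPath.eq_of_adj_getVert {G : SimpleGraph V} [DecidableRel G.Adj] {c l : V}
    {p : G.Walk c l} (hp : p.IsPath) (hl : G.degree l = 1) {i : ℕ} (hi : i ≤ p.length)
    (hi1 : 1 ≤ i) (hdeg : G.degree (p.getVert i) ≤ 2) {a : V} (ha : G.Adj (p.getVert i) a) :
    a = p.getVert (i - 1) ∨ i + 1 ≤ p.length ∧ a = p.getVert (i + 1) := by
  classical
  have hprev : G.Adj (p.getVert i) (p.getVert (i - 1)) := by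
    have := p.adj_getVert_succ (i := i - 1) (by omega)
    rw [Nat.sub_add_cancel hi1] at this
    exact this.symm
  by_contra! hc
  obtain ⟨h1, h2⟩ := hc
  by_cases him : i + 1 ≤ p.length
  · have hnext : G.Adj (p.getVert i) (p.getVert (i + 1)) := p.adj_getVert_succ him
    have hne : p.getVert (i - 1) ≠ p.getVert (i + 1) := fun h => by
      have := hp.getVert_inj (by omega) him h
      omega
    have hsub : ({a, p.getVert (i - 1), p.getVert (i + 1)} : Finset V) ⊆
        G.neighborFinset (p.getVert i) := by
      intro x hx
      simp only [Finset.mem_insert, Finset.mem_singleton] at hx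
      rw [mem_neighborFinset]
      rcases hx with rfl | rfl | rfl <;> assumption
    have := Finset.card_le_card hsub
    rw [Finset.card_eq_three.2 ⟨_, _, _, h1, h2 him, hne, rfl⟩, card_neighborFinset_eq_degree]
      at this
    omega
  · have hil : p.getVert i = l := by
      rw [show i = p.length by omega]
      exact p.getVert_length
    have hsub : ({a, p.getVert (i - 1)} : Finset V) ⊆ G.neighborFinset (p.getVert i) := by
      intro x hx
      simp only [Finset.mem_insert, Finset.mem_singleton] at hx
      rw [mem_neighborFinset]
      rcases hx with rfl | rfl <;> assumption
    have := Finset.card_le_card hsub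
    rw [Finset.card_pair h1, card_neighborFinset_eq_degree, hil, hl] at this
    omega

namespace IsTreeShiftData

variable [DecidableEq V] {G : SimpleGraph V} [DecidableRel G.Adj] {l c : V} {p : G.Walk c l}
  {F : Set V}

/-- Let `p i` be the branch vertex nearest to `l` along the path. The path beyond it has no side
exits, so every walk from `l` to `c` passes back to `p i` and then takes at least one more step.
Thus `p i` would be nearer to `l` than `c`. -/
theorem degree_getVert_le (h : G.IsTreeShiftData l c p F) (hG : G.Connected) :
    ∀ i ≤ p.length, 1 ≤ i → G.degree (p.getVert i) ≤ 2 := by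
  have key : ∀ n i, p.length - i = n → i ≤ p.length → 1 ≤ i → G.degree (p.getVert i) ≤ 2 := by
    intro n
    induction n using Nat.strong_induction_on with
    | _ n ih =>
    rintro i rfl hi hi1
    by_contra! hdeg
    have hwalk : ∀ {x y : V} (w : G.Walk x y), y = c → ∀ j, i ≤ j → j ≤ p.length →
        x = p.getVert j → j - i + 1 ≤ w.length := by
      intro x y w
      induction w with
      | nil =>
        rintro rfl j hij hj hxj
        have := h.isPath.getVert_inj (Nat.zero_le _) hj (by rw [Walk.getVert_zero]; exact hxj)
        omega
      | cons hadj w ihw =>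
        rintro rfl j hij hj rfl
        rw [Walk.length_cons]
        rcases hij.eq_or_lt with rfl | hij'
        · omega
        · rcases h.isPath.eq_of_adj_getVert h.leaf hj (by omega)
            (ih _ (by omega) j rfl hj (by omega)) hadj with e | ⟨hj', e⟩
          · have := ihw rfl (j - 1) (by omega) (by omega) e
            omega
          · have := ihw rfl (j + 1) (by omega) (by omega) e
            omega
    obtain ⟨w, hw⟩ := hG.exists_walk_length_eq_dist l c
    have h1 := hwalk w rfl p.length hi le_rfl p.getVert_length.symm
    have h2 := h.nearest _ hdeg
    have h3 : G.dist l (p.getVert i) ≤ p.length - i := by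
      rw [dist_comm, ← Walk.drop_length p i]
      exact dist_le _
    omega
  exact fun i hi hi1 => key _ i rfl hi hi1

theorem eq_of_adj (h : G.IsTreeShiftData l c p F) (hG : G.Connected) {i : ℕ}
    (hi : i ≤ p.length) (hi1 : 1 ≤ i) {a : V} (ha : G.Adj (p.getVert i) a) :
    a = p.getVert (i - 1) ∨ i + 1 ≤ p.length ∧ a = p.getVert (i + 1) :=
  h.isPath.eq_of_adj_getVert h.leaf hi hi1 (h.degree_getVert_le hG i hi hi1) ha

theorem root_notMem (h : G.IsTreeShiftData l c p F) : c ∉ F :=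
  fun hc => h.disjoint c hc p.start_mem_support

theorem leaf_notMem (h : G.IsTreeShiftData l c p F) : l ∉ F :=
  fun hc => h.disjoint l hc p.end_mem_support

/-- The graph without the edges between `F` and `c`. -/
abbrev base (G : SimpleGraph V) (F : Set V) (c : V) : SimpleGraph V :=
  G.deleteEdges {e | ∃ v ∈ F, e = s(v, c)}

theorem base_adj {a b : V} : (base G F c).Adj a b ↔
    G.Adj a b ∧ ¬ (a ∈ F ∧ b = c ∨ b ∈ F ∧ a = c) := by
  rw [base, deleteEdges_adj, Set.mem_ofPred_eq]
  refine and_congr_right fun _ => not_congr ?_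
  constructor
  · rintro ⟨v, hv, h⟩
    rcases Sym2.eq_iff.1 h with ⟨rfl, rfl⟩ | ⟨rfl, rfl⟩
    · exact Or.inl ⟨hv, rfl⟩
    · exact Or.inr ⟨hv, rfl⟩
  · rintro (⟨h, rfl⟩ | ⟨h, rfl⟩)
    · exact ⟨a, h, rfl⟩
    · exact ⟨b, h, Sym2.eq_swap⟩

open scoped Classical in
theorem attach_base :
    (base G F c).attach (Finset.univ.filter fun v => v ∈ F ∧ G.Adj v c) c = G := by
  ext a b
  rw [attach_adj, base_adj]
  simp only [Finset.mem_filter, Finset.mem_univ, true_and]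
  constructor
  · rintro ⟨-, h | ⟨rfl, -, h⟩ | ⟨rfl, -, h⟩⟩
    · exact h.1
    · exact h.symm
    · exact h
  · intro h
    refine ⟨h.ne, ?_⟩
    by_cases h' : a ∈ F ∧ b = c ∨ b ∈ F ∧ a = c
    · rcases h' with ⟨h1, rfl⟩ | ⟨h1, rfl⟩
      · exact Or.inr (Or.inr ⟨rfl, h1, h⟩)
      · exact Or.inr (Or.inl ⟨rfl, h1, h.symm⟩)
    · exact Or.inl ⟨h, h'⟩

open scoped Classical in
theorem attach_base_eq_reattach (hl : l ∉ F) :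
    (base G F c).attach (Finset.univ.filter fun v => v ∈ F ∧ G.Adj v c) l =
      G.reattach F c l := by
  ext a b
  rw [attach_adj, reattach, sup_adj, fromEdgeSet_adj, Set.mem_ofPred_eq]
  simp only [Finset.mem_filter, Finset.mem_univ, true_and]
  constructor
  · rintro ⟨h0, h | ⟨rfl, h1, h2⟩ | ⟨rfl, h1, h2⟩⟩
    · exact Or.inl h
    · exact Or.inr ⟨⟨b, h1, h2, Sym2.eq_swap⟩, h0⟩
    · exact Or.inr ⟨⟨a, h1, h2, rfl⟩, h0⟩
  · rintro (h | ⟨⟨v, h1, h2, h3⟩, h0⟩)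
    · exact ⟨h.ne, Or.inl h⟩
    · refine ⟨h0, Or.inr ?_⟩
      rcases Sym2.eq_iff.1 h3 with ⟨rfl, rfl⟩ | ⟨rfl, rfl⟩
      · exact Or.inr ⟨rfl, h1, h2⟩
      · exact Or.inl ⟨rfl, h1, h2⟩

open scoped Classical in
-- Here `A` is `c` together with all vertices off both the path and `F`. Closedness of `F` separates
-- it once its edges to `c` are removed, and the degree bound confines the edges at later path
-- vertices to the path.
theorem shiftConfig (h : G.IsTreeShiftData l c p F) (hG : G.Connected) :
    ShiftConfig (base G F c) (Finset.univ.filter fun v => v ∉ F ∧ (v ∈ p.support → v = c))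
      (Finset.univ.filter (· ∈ F)) (Finset.univ.filter fun v => v ∈ F ∧ G.Adj v c)
      p.length p.getVert := by
  have hpF : ∀ i, p.getVert i ∉ F := fun i hi => h.disjoint _ hi (p.getVert_mem_support i)
  constructor
  · simp [h.root_notMem]
  · exact fun v hv => by
      simp only [Finset.mem_filter, Finset.mem_univ, true_and] at hv ⊢
      exact hv.1
  · exact Finset.disjoint_left.2 fun v hv => by
      simp only [Finset.mem_filter, Finset.mem_univ, true_and] at hv ⊢
      exact hv.1
  · exact fun i hi j hj => h.isPath.getVert_inj hi hj
  · intro i hi hi1 hA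
    simp only [Finset.mem_filter, Finset.mem_univ, true_and] at hA
    have := h.isPath.getVert_inj hi (Nat.zero_le _)
      ((hA.2 (p.getVert_mem_support i)).trans p.getVert_zero.symm)
    omega
  · intro i _
    simp [hpF i]
  · intro i hi
    exact base_adj.2 ⟨p.adj_getVert_succ hi, by simp [hpF]⟩
  · intro a ha b hb hab
    have haF : a ∉ F := by
      rcases Finset.mem_union.1 ha with ha | ha
      · exact (Finset.mem_filter.1 ha).2.1
      · obtain ⟨i, -, rfl⟩ := mem_pathSet.1 ha
        exact hpF i
    have hbF := (Finset.mem_filter.1 hb).2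
    obtain ⟨hab, hn⟩ := base_adj.1 hab
    rcases h.closed b hbF a hab.symm with rfl | h'
    · exact hn (Or.inr ⟨hbF, rfl⟩)
    · exact haF h'
  · intro i hi hi1 a ha hab
    simp only [Finset.mem_filter, Finset.mem_univ, true_and] at ha
    have hap : ∀ j ≤ p.length, a = p.getVert j → j = 0 ∧ a = p.getVert 0 := by
      rintro j hj rfl
      have := (ha.2 (p.getVert_mem_support j)).trans p.getVert_zero.symm
      exact ⟨h.isPath.getVert_inj hj (Nat.zero_le _) this, this⟩
    rcases h.eq_of_adj hG hi hi1 (base_adj.1 hab).1 with e | ⟨hi', e⟩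
    · have := hap _ (by omega) e
      exact ⟨by omega, this.2⟩
    · have := hap _ hi' e
      omega
  · intro j hj i hij hab
    rcases h.eq_of_adj hG hj (by omega) (base_adj.1 hab).1.symm with e | ⟨hj', e⟩
    · have := h.isPath.getVert_inj (by omega) (by omega) e
      omega
    · have := h.isPath.getVert_inj (by omega) hj' e
      omega

/-- A tree shift does not increase the `γ`-polynomial of the graph-associahedron. -/
theorem graphGamma_reattach_le (h : G.IsTreeShiftData l c p F) (hG : G.Connected) :
    CoeffLE (graphGamma (G.reattach F c l) Finset.univ) (graphGamma G Finset.univ) := by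
  classical
  have hle := (h.shiftConfig hG).graphGamma_le
  rw [p.getVert_length, p.getVert_zero, attach_base, attach_base_eq_reattach h.leaf_notMem] at hle
  convert hle
  all_goals
    symm
    rw [Finset.eq_univ_iff_forall]
    intro v
    simp only [Finset.mem_union, Finset.mem_filter, Finset.mem_univ, true_and, mem_pathSet]
    by_cases hF : v ∈ F
    · exact Or.inr hF
    · by_cases hp : v ∈ p.support
      · obtain ⟨i, hi, hil⟩ := Walk.mem_support_iff_exists_getVert.1 hp
        exact Or.inl (Or.inr ⟨i, hil, hi⟩)
      · exact Or.inl (Or.inl ⟨hF, fun h => (hp h).elim⟩)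

end IsTreeShiftData

end TreeShift

end SimpleGraph

theorem theorem4p1 {V : Type*} [Fintype V] [DecidableEq V] (G G' : SimpleGraph V)
    [DecidableRel G.Adj] (hG : G.Connected) (hshift : G.IsTreeShift G') :
    IsGammaPolynomial G.graphAssociahedron (gammaPolynomial G.graphAssociahedron) ∧
    IsGammaPolynomial G'.graphAssociahedron (gammaPolynomial G'.graphAssociahedron) ∧
    ∀ i : ℕ, (gammaPolynomial G'.graphAssociahedron).coeff i ≤
      (gammaPolynomial G.graphAssociahedron).coeff i := by
  obtain ⟨l, c, p, F, h, rfl⟩ := hshift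
  have : Nonempty V := hG.nonempty
  rw [SimpleGraph.gammaPolynomial_graphAssociahedron,
    SimpleGraph.gammaPolynomial_graphAssociahedron]
  refine ⟨SimpleGraph.isGammaPolynomial_graphAssociahedron G,
    SimpleGraph.isGammaPolynomial_graphAssociahedron _, fun i => ?_⟩
  obtain ⟨r, hr⟩ := h.graphGamma_reattach_le hG
  rw [hr]
  simp
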